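/- Let $k$ be a field, let $m \geqslant 0$, let $R = k[x_0, x_1, \dotsc, x_m]$ be the standard graded polynomial ring, and let $\mathbb{P}^m = \operatorname{Proj}(R)$. **Lexicographic ideals.** Order the monomials of $R$ by $x_0^{b_0} \dotsm x_m^{b_m} > x_0^{c_0} \dotsm x_m^{c_m}$ whenever the first nonzero entry of $(b_0 - c_0, \dotsc, b_m - c_m)$ is positive. A monomial ideal $I \subseteq R$ is *lexicographic* if, for all $j$, the component $I_j$ is spanned by the $\dim_k I_j$ largest monomials of degree $j$. For an integer partition $\lambda = (\lambda_1 \geqslant \dotsb \geqslant \lambda_r \geqslant 1)$ with $\lambda_1 \leqslant m$, let $L(\lambda)$ denote the lexicographic ideal in $R$ such that $\dim_k (R/L(\lambda))_j = \sum_{i=1}^r \binom{j + \lambda_i - i}{j - i + 1}$ for all integers $j$, where $\binom{t}{c} = \frac{1}{c!} t(t-1)\dotsm(t-c+1)$ for $c \geqslant 0$ and $\binom{t}{c} = 0$ for $c < 0$. **Residual flags.** Let $D \subseteq X$ be closed subschemes of $\mathbb{P}^n$ where $D$ is a relative effective Cartier divisor over $\operatorname{Spec} k$ (it is flat over $\operatorname{Spec}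 k$ and its ideal sheaf is invertible). The residual scheme to $D$ in $X$ is the closed subscheme with ideal sheaf $(\mathcal{I}_X : \mathcal{I}_D)$. The divisor $D$ has degree $d$ if every geometric fibre of $D$ is a hypersurface of degree $d$. A closed immersion $Y \subseteq X$ in $\mathbb{P}^n$ is a *$d$-residual inclusion* in $\mathbb{P}^n$ if $Y$ is the residual scheme to $D$ in $X$ for some relative effective Cartier divisor $D \subseteq X$ of degree $d$ in $\mathbb{P}^n$. Let $(n,d) = (n_1, d_1), \dotsc, (n_e, d_e)$ be a sequence of pairs of positive integers with $m \geqslant n_1 > n_2 > \dotsb > n_e$. A *residual flag* of type $(n,d)$ in $\mathbb{P}^m$ is a chain of closed subschemes $\varnothing = X_{e+1} \subseteq X_e \subseteq \dotsb \subseteq X_1$ of $\mathbb{P}^m$ such that, for all $1 \leqslant i \leqslant e$, the scheme $X_i$ is flat over $\operatorname{Spec} k$, and there is an $n_i$-plane (a linear subspace of dimension $n_i$) $\Lambda_i \cong \mathbb{P}^{n_i}$ in $\mathbb{P}^m$ that contains $X_i$ and in which $X_{i+1} \subseteq X_i$ is a $d_i$-residual inclusion. **Statement.** Let $(n,d) =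 (n_1, d_1), \dotsc, (n_e, d_e)$ be a sequence of pairs of positive integers with $m \geqslant n_1 > n_2 > \dotsb > n_e$. For each $1 \leqslant i \leqslant e$, the lexicographic ideal $L(n_i^{d_i}, n_{i+1}^{d_{i+1}}, \dotsc, n_e^{d_e})$, for the partition in which each $n_j$ with $j \geqslant i$ occurs exactly $d_j$ times, exists and is unique; let $X_i$ be the closed subscheme of $\mathbb{P}^m$ that it defines. Then the chain $\varnothing \subseteq X_e \subseteq X_{e-1} \subseteq \dotsb \subseteq X_1$ is a residual flag of type $(n,d)$ in $\mathbb{P}^m$. -/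

import Mathlib

open AlgebraicGeometry CategoryTheory

universe u

noncomputable section

namespace ResidualFlag

/-! ### Projective space over a field -/

section ProjectiveSpace

/-- The standard graded polynomial ring `k[x₀, …, xₘ]`. -/
abbrev Poly (k : Type u) [Field k] (m : ℕ) : Type u := MvPolynomial (Fin (m + 1)) k

/-- The grading of `k[x₀, …, xₘ]` by total degree. -/
abbrev grading (k : Type u) [Field k] (m : ℕ) : ℕ → Submodule k (Poly k m) :=
  MvPolynomial.homogeneousSubmodule (Fin (m + 1)) k

instance gradedRing (k : Type u) [Field k] (m : ℕ) : GradedAlgebra (grading k m) :=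
  MvPolynomial.gradedAlgebra

/-- Projective space `ℙᵐ = Proj k[x₀, …, xₘ]`. -/
abbrev ProjSpace (k : Type u) [Field k] (m : ℕ) : Scheme.{u} := Proj (grading k m)

/-- The structure morphism `ℙᵐ ⟶ Spec k`. -/
def structureMap (k : Type u) [Field k] (m : ℕ) : ProjSpace k m ⟶ Spec (.of k) :=
  Proj.toSpecZero (grading k m) ≫
    Spec.map (CommRingCat.ofHom (algebraMap k (grading k m 0)))

theorem X_mem_grading (k : Type u) [Field k] {m : ℕ} (i : Fin (m + 1)) :
    (MvPolynomial.X i : Poly k m) ∈ grading k m 1 :=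
  (MvPolynomial.mem_homogeneousSubmodule _ _).2 (MvPolynomial.isHomogeneous_X k i)

/-- The standard affine chart `D₊(xᵢ) = Spec R_(xᵢ) ⟶ ℙᵐ`. -/
def chart (k : Type u) [Field k] {m : ℕ} (i : Fin (m + 1)) :
    Spec (.of (HomogeneousLocalization.Away (grading k m) (MvPolynomial.X i))) ⟶ ProjSpace k m :=
  Proj.awayι (grading k m) (MvPolynomial.X i) (X_mem_grading k i) one_pos

/-- The ideal `I_(xᵢ) = I · R_{xᵢ} ∩ R_(xᵢ)` of the degree-zero part of `R_{xᵢ}`. -/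
def chartIdeal {k : Type u} [Field k] {m : ℕ} (I : Ideal (Poly k m)) (i : Fin (m + 1)) :
    Ideal (HomogeneousLocalization.Away (grading k m) (MvPolynomial.X i)) :=
  (I.map (algebraMap (Poly k m) (Localization.Away (MvPolynomial.X i : Poly k m)))).comap
    (algebraMap (HomogeneousLocalization.Away (grading k m) (MvPolynomial.X i))
      (Localization.Away (MvPolynomial.X i : Poly k m)))

/-- The ideal sheaf on `Spec A` attached to an ideal of `A`. -/
def specIdealSheaf {A : Type u} [CommRing A] (I : Ideal A) : (Spec (.of A)).IdealSheafData :=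
  Scheme.IdealSheafData.ofIdealTop (I.map (Scheme.ΓSpecIso (.of A)).inv.hom)

/-- The closed subscheme of `ℙᵐ` defined by a homogeneous ideal `I`, given by its ideal sheaf: a
section belongs to it when its restriction to every standard chart `D₊(xᵢ)` lies in `I_(xᵢ)`.
(Closed subschemes are represented throughout by their quasi-coherent ideal sheaves, so that
`X ⊆ Y` reads `Y ≤ X`, and the empty subscheme is `⊤`.) -/
def closedSubscheme {k : Type u} [Field k] {m : ℕ} (I : Ideal (Poly k m)) :
    (ProjSpace k m).IdealSheafData :=
  ⨅ i : Fin (m + 1), (specIdealSheaf (chartIdeal I i)).map (chart k i)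

theorem irrelevant_le_of_X_mem {k : Type u} [Field k] {m : ℕ} {I : Ideal (Poly k m)}
    (h : ∀ i, MvPolynomial.X i ∈ I) :
    (HomogeneousIdeal.irrelevant (grading k m)).toIdeal ≤ I := by
  refine (HomogeneousIdeal.toIdeal_irrelevant_le _).2 fun i hi p hp => ?_
  have hle : Ideal.span (MvPolynomial.X '' (Set.univ : Set (Fin (m + 1)))) ≤ I := by
    rw [Ideal.span_le]
    rintro _ ⟨j, -, rfl⟩
    exact h j
  refine hle (MvPolynomial.mem_ideal_span_X_image.2 fun b hb => ?_)
  by_contra! hcon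
  have hb0 : b = 0 := Finsupp.ext fun j => hcon j trivial
  have := (MvPolynomial.mem_homogeneousSubmodule _ _).1 hp (MvPolynomial.mem_support_iff.1 hb)
  rw [hb0, map_zero] at this
  omega

theorem X_mem_irrelevant {k : Type u} [Field k] {m : ℕ} (i : Fin (m + 1)) :
    (MvPolynomial.X i : Poly k m) ∈ (HomogeneousIdeal.irrelevant (grading k m)).toIdeal :=
  HomogeneousIdeal.mem_irrelevant_of_mem (grading k m) one_pos (X_mem_grading k i)

end ProjectiveSpace

/-! ### Linear subspaces and base change -/

section Morphisms

/-- The homomorphism `Sym φ : k[x₀, …, xₘ] → k[y₀, …, yₙ]` of symmetric algebras induced by a linear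
map `φ : kᵐ⁺¹ → kⁿ⁺¹`, where `xᵢ` and `yⱼ` denote the standard basis vectors. -/
def symHom {k : Type u} [Field k] {m n : ℕ}
    (φ : (Fin (m + 1) → k) →ₗ[k] (Fin (n + 1) → k)) : grading k m →+*ᵍ grading k n where
  __ := (MvPolynomial.aeval fun i : Fin (m + 1) =>
    ∑ j : Fin (n + 1), φ (Pi.single i 1) j • (MvPolynomial.X j : Poly k n)).toRingHom
  map_mem := by
    intro i p hp
    rw [MvPolynomial.mem_homogeneousSubmodule] at hp ⊢
    have hlin : ∀ i : Fin (m + 1), (∑ j : Fin (n + 1),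
        φ (Pi.single i 1) j • (MvPolynomial.X j : Poly k n)).IsHomogeneous 1 := fun i =>
      (MvPolynomial.mem_homogeneousSubmodule _ _).1 <|
        Submodule.sum_mem (grading k n 1) fun j _ =>
          Submodule.smul_mem _ _ (X_mem_grading k j)
    have := hp.aeval _ hlin
    simpa using this

theorem symHom_irrelevant {k : Type u} [Field k] {m n : ℕ}
    (φ : (Fin (m + 1) → k) →ₗ[k] (Fin (n + 1) → k)) (hφ : Function.Surjective φ) :
    HomogeneousIdeal.irrelevant (grading k n) ≤
      (HomogeneousIdeal.irrelevant (grading k m)).map (symHom φ) := by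
  refine irrelevant_le_of_X_mem fun j => ?_
  obtain ⟨v, hv⟩ := hφ (Pi.single j 1)
  have hmem : ∑ i, v i • (MvPolynomial.X i : Poly k m) ∈
      (HomogeneousIdeal.irrelevant (grading k m)).toIdeal :=
    Submodule.sum_mem _ fun i _ => Submodule.smul_of_tower_mem _ _ (X_mem_irrelevant i)
  have himg : symHom φ (∑ i, v i • (MvPolynomial.X i : Poly k m)) = MvPolynomial.X j := by
    change (MvPolynomial.aeval fun i : Fin (m + 1) =>
      ∑ j : Fin (n + 1), φ (Pi.single i 1) j • (MvPolynomial.X j : Poly k n)) _ = _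
    have hsum : ∀ j', ∑ i, v i * φ (Pi.single i 1) j' = φ v j' := fun j' => by
      conv_rhs => rw [← Finset.univ_sum_single v]
      rw [map_sum, Finset.sum_apply]
      refine Finset.sum_congr rfl fun i _ => ?_
      have : (Pi.single i (v i) : Fin (m + 1) → k) = v i • Pi.single i 1 := by
        rw [← Pi.single_smul, smul_eq_mul, mul_one]
      rw [this, map_smul, Pi.smul_apply, smul_eq_mul]
    simp only [map_sum, map_smul, MvPolynomial.aeval_X, Finset.smul_sum, smul_smul]
    rw [Finset.sum_comm]
    simp only [← Finset.sum_smul, hsum, hv]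
    rw [Finset.sum_eq_single j] <;> simp +contextual
  rw [← himg]
  exact Ideal.mem_map_of_mem (symHom φ) hmem

/-- The closed immersion `ℙ(F) ⟶ ℙ(E)` of an `n`-plane in `ℙᵐ = ℙ(E)`, `E = kᵐ⁺¹`, determined by a
surjection `φ : E → F` onto a vector space `F = kⁿ⁺¹` of dimension `n + 1`. -/
def planeMap {k : Type u} [Field k] {m n : ℕ}
    (φ : (Fin (m + 1) → k) →ₗ[k] (Fin (n + 1) → k)) (hφ : Function.Surjective φ) :
    ProjSpace k n ⟶ ProjSpace k m :=
  Proj.map (symHom φ) (symHom_irrelevant φ hφ)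

/-- Extension of scalars `k[x₀, …, xₙ] → K[x₀, …, xₙ]`. -/
def extendScalarsHom (k K : Type u) [Field k] [Field K] [Algebra k K] (n : ℕ) :
    grading k n →+*ᵍ grading K n where
  __ := MvPolynomial.map (algebraMap k K)
  map_mem := by
    intro i p hp
    rw [MvPolynomial.mem_homogeneousSubmodule] at hp ⊢
    exact hp.map _

theorem extendScalarsHom_irrelevant (k K : Type u) [Field k] [Field K] [Algebra k K] (n : ℕ) :
    HomogeneousIdeal.irrelevant (grading K n) ≤
      (HomogeneousIdeal.irrelevant (grading k n)).map (extendScalarsHom k K n) := by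
  refine irrelevant_le_of_X_mem fun j => ?_
  have himg : extendScalarsHom k K n (MvPolynomial.X j) = MvPolynomial.X j :=
    MvPolynomial.map_X _ _
  rw [← himg]
  exact Ideal.mem_map_of_mem (extendScalarsHom k K n) (X_mem_irrelevant j)

/-- The projection `ℙⁿ_K = ℙⁿ_k ×_k Spec K ⟶ ℙⁿ_k`. -/
def extendScalarsMap (k K : Type u) [Field k] [Field K] [Algebra k K] (n : ℕ) :
    ProjSpace K n ⟶ ProjSpace k n :=
  Proj.map (extendScalarsHom k K n) (extendScalarsHom_irrelevant k K n)

end Morphisms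

/-! ### Relative effective Cartier divisors and residual schemes -/

section Residual

/-- An ideal sheaf is invertible if it is locally free of rank one. -/
def IsInvertible {P : Scheme.{u}} (D : P.IdealSheafData) : Prop :=
  ∀ x : P, ∃ U : P.affineOpens, x ∈ U.1 ∧ Nonempty (D.ideal U ≃ₗ[Γ(P, U)] Γ(P, U))

/-- A closed subscheme of `ℙⁿ_k` is a hypersurface of degree `d` if it is defined by a nonzero
homogeneous polynomial of degree `d`. -/
def IsHypersurface {k : Type u} [Field k] {n : ℕ} (d : ℕ) (D : (ProjSpace k n).IdealSheafData) :
    Prop :=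
  ∃ f : Poly k n, f ≠ 0 ∧ f.IsHomogeneous d ∧ D = closedSubscheme (Ideal.span {f})

/-- A closed subscheme of `ℙᵐ` is flat over the base `Spec k`. -/
def IsFlat {k : Type u} [Field k] {m : ℕ} (X : (ProjSpace k m).IdealSheafData) : Prop :=
  Flat (X.subschemeι ≫ structureMap k m)

/-- Relative effective Cartier divisors of degree `d` in `ℙⁿ_k` over `Spec k`: flat over the base,
with invertible ideal sheaf, and with every geometric fibre a hypersurface of degree `d`. -/
structure IsRelEffCartier {k : Type u} [Field k] {n : ℕ} (d : ℕ)
    (D : (ProjSpace k n).IdealSheafData) : Prop where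
  flat : IsFlat D
  invertible : IsInvertible D
  degree : ∀ (K : Type u) [Field K] [IsAlgClosed K] [Algebra k K],
    IsHypersurface d (D.comap (extendScalarsMap k K n))

/-- The colon ideal sheaf `(X : D)`: the largest ideal sheaf whose product with `D` lies in `X`. -/
def colon {P : Scheme.{u}} (X D : P.IdealSheafData) : P.IdealSheafData :=
  sSup {J | J * D ≤ X}

/-- `Y ⊆ X` is a `d`-residual inclusion in `ℙⁿ`: there is a relative effective Cartier divisor
`D ⊆ X` of degree `d` such that `Y` is the residual scheme to `D` in `X`. -/
def IsResidualInclusion {k : Type u} [Field k] {n : ℕ} (d : ℕ)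
    (Y X : (ProjSpace k n).IdealSheafData) : Prop :=
  ∃ D : (ProjSpace k n).IdealSheafData, IsRelEffCartier d D ∧ X ≤ D ∧ Y = colon X D

/-- The sequences `(n₁, d₁), …, (nₑ, dₑ)` of pairs of positive integers with `n₁ > ⋯ > nₑ`, that are
the type of a residual flag in `ℙᵐ`; the planes `ℙ(Fᵢ) ⊆ ℙᵐ` have dimension `nᵢ ≤ m`. -/
structure IsFlagType (m : ℕ) {e : ℕ} (n d : Fin e → ℕ) : Prop where
  strictAnti : StrictAnti n
  n_pos : ∀ i, 0 < n i
  d_pos : ∀ i, 0 < d i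
  n_le : ∀ i, n i ≤ m

/-- The chain `∅ = X_{e+1} ⊆ X_e ⊆ ⋯ ⊆ X_1` of closed subschemes of `ℙᵐ` (indexed here by
`0, …, e` in place of `1, …, e + 1`) is a residual flag of type `(n, d)`. When a closed subscheme
lies in the plane `ℙ(Fᵢ)`, its pullback to the plane is the same subscheme viewed inside it. -/
structure IsResidualFlag {k : Type u} [Field k] {m e : ℕ} (n d : Fin e → ℕ)
    (X : Fin (e + 1) → (ProjSpace k m).IdealSheafData) : Prop where
  last_eq_empty : X (Fin.last e) = ⊤
  chain : ∀ i : Fin e, X i.castSucc ≤ X i.succ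
  flat : ∀ i : Fin e, IsFlat (X i.castSucc)
  residual : ∀ i : Fin e, ∃ (φ : (Fin (m + 1) → k) →ₗ[k] (Fin (n i + 1) → k))
    (hφ : Function.Surjective φ),
    (planeMap φ hφ).ker ≤ X i.castSucc ∧
    IsResidualInclusion (d i) ((X i.succ).comap (planeMap φ hφ))
      ((X i.castSucc).comap (planeMap φ hφ))

end Residual

/-! ### Lexicographic ideals -/

section Lexicographic

/-- The `N` largest monomials of degree `j` in `k[x₀, …, xₘ]`, as exponent vectors, for the
lexicographic order: `b > c` if the first nonzero entry of `b - c` is positive. -/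
def largestMonomials (m j N : ℕ) : Set (Fin (m + 1) →₀ ℕ) :=
  {b | b.degree = j ∧ {c : Fin (m + 1) →₀ ℕ | c.degree = j ∧ toLex b < toLex c}.ncard < N}

/-- The homogeneous component `I_j` of an ideal `I`. -/
def component {k : Type u} [Field k] {m : ℕ} (I : Ideal (Poly k m)) (j : ℕ) :
    Submodule k (Poly k m) :=
  I.restrictScalars k ⊓ grading k m j

/-- A lexicographic ideal: a monomial ideal whose component in each degree `j` is spanned by the
`dim I_j` largest monomials of degree `j`. -/
structure IsLexicographic {k : Type u} [Field k] {m : ℕ} (I : Ideal (Poly k m)) : Prop where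
  monomial : ∃ S : Set (Fin (m + 1) →₀ ℕ),
    I = Ideal.span ((fun b => MvPolynomial.monomial b (1 : k)) '' S)
  largest : ∀ j : ℕ, component I j = Submodule.span k
    ((fun b => MvPolynomial.monomial b (1 : k)) ''
      largestMonomials m j (Module.finrank k (component I j)))

/-- The Hilbert function `h_{R/I}(j) = dim (R/I)_j`. -/
def hilbertFunction {k : Type u} [Field k] {m : ℕ} (I : Ideal (Poly k m)) (j : ℕ) : ℕ :=
  Module.finrank k ((grading k m j).map (Ideal.Quotient.mkₐ k I).toLinearMap)

/-- The binomial coefficient `t (t - 1) ⋯ (t - c + 1) / c!`, which is zero for `c < 0`. -/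
def binom (t c : ℤ) : ℤ := if 0 ≤ c then Ring.choose t c.toNat else 0

/-- `I` is the lexicographic ideal `L(l)` of the integer partition `l = (l₁, …, l_r)`: it is
lexicographic with Hilbert function
`h_{R/I}(j) = ∑_{i = 1}^r binom (j + lᵢ - i) (j - i + 1)`; below, `i` runs from `0` to `r - 1`. -/
structure IsLexIdealOf {k : Type u} [Field k] {m : ℕ} (l : List ℕ) (I : Ideal (Poly k m)) :
    Prop where
  lexicographic : IsLexicographic I
  hilbert : ∀ j : ℕ, (hilbertFunction I j : ℤ) =
    ∑ i : Fin l.length, binom ((j : ℤ) + l[i] - ((i : ℤ) + 1)) ((j : ℤ) - ((i : ℤ) + 1) + 1)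

/-- The integer partition `(nᵢ^dᵢ, nᵢ₊₁^dᵢ₊₁, …, nₑ^dₑ)`, in which `nⱼ` occurs `dⱼ` times. -/
def tailPartition {e : ℕ} (n d : Fin e → ℕ) (i : Fin e) : List ℕ :=
  ((List.finRange e).drop i).flatMap fun j => List.replicate (d j) (n j)

end Lexicographic

end ResidualFlag

end

noncomputable section

namespace ResidualFlag

/-! ### Lexicographic ideals generated by an upper set of monomials -/

section LexIdeal

open MvPolynomial

variable {k : Type u} [Field k] {m : ℕ}

/-! The ideal `L(λ)` is written down explicitly. Attach to `λ` the monomial `x^D` with `D = ∑ᵢ e_{m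
- λᵢ}` (`partExponent`), and let `lexIdeal D` be spanned by all monomials, of any degree, that are
at least `x^D` in the pure lexicographic order. Divisibility implies this order, so the spanning set
is closed under multiplication and each graded component is an initial segment of largest monomials.

Its Hilbert function counts the monomials of degree `j` below `x^D`. Adding the parts of `λ` one at
a time, from the largest, adds one block of monomials per part, and the size of that block is the
corresponding binomial coefficient (`ncard_lt_add_single`, `ncard_lt_partExponent`). A lexicographic
ideal is determined by its Hilbert function, whence uniqueness.

The flag comes from one factorization (`lexIdeal_single_add`): if `D` involves no variable before
`x_p`, then `lexIdeal (d e_p + D) = (x_0, …, x_{p-1}) + x_p^d · lexIdeal D`. For `p = m - n` the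
linear forms cut out an `n`-plane containing the subscheme. On that plane the ideal is `g · I`,
where `g = x_p^d` and `I` is the restriction of `lexIdeal D`. The chart rings are domains, so `(g I
: g) = I` (`colon_closedSubscheme`), and the residual scheme to `g = 0` is the next member of the
flag.

The rest translates between homogeneous ideals and ideal sheaves: dehomogenize on the standard
charts, check agreement on overlaps, and compute pullbacks chart by chart. -/

/-- The ideal spanned by the monomials that are at least `x^D` in the lexicographic order. -/
def lexIdeal (k : Type u) [Field k] {m : ℕ} (D : Fin (m + 1) →₀ ℕ) : Ideal (Poly k m) :=
  Ideal.span ((fun b => monomial b (1 : k)) '' {b | toLex D ≤ toLex b})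

/-- A multiple of a monomial is lexicographically at least that monomial, so the spanning monomials
already form an upper set for divisibility and membership is read off the support. -/
theorem mem_lexIdeal {D : Fin (m + 1) →₀ ℕ} {p : Poly k m} :
    p ∈ lexIdeal k D ↔ ∀ b ∈ p.support, toLex D ≤ toLex b := by
  rw [lexIdeal, mem_ideal_span_monomial_image]
  refine forall₂_congr fun b _ => ⟨?_, fun h => ⟨b, h, le_rfl⟩⟩
  rintro ⟨c, hc, hcb⟩
  exact le_trans hc (Finsupp.toLex_monotone hcb)

theorem monomial_mem_lexIdeal {D b : Fin (m + 1) →₀ ℕ} (h : toLex D ≤ toLex b) :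
    monomial b (1 : k) ∈ lexIdeal k D :=
  Ideal.subset_span ⟨b, h, rfl⟩

theorem lexIdeal_anti {D E : Fin (m + 1) →₀ ℕ} (h : toLex D ≤ toLex E) :
    lexIdeal k E ≤ lexIdeal k D := fun _ hp =>
  mem_lexIdeal.2 fun b hb => h.trans (mem_lexIdeal.1 hp b hb)

theorem toLex_lt_iff {b c : Fin (m + 1) →₀ ℕ} :
    toLex b < toLex c ↔ ∃ i, (∀ j, j < i → b j = c j) ∧ b i < c i := Iff.rfl

theorem lexIdeal_zero : lexIdeal k (0 : Fin (m + 1) →₀ ℕ) = ⊤ :=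
  top_le_iff.1 fun _ _ => mem_lexIdeal.2 fun _ _ => Finsupp.toLex_monotone zero_le

theorem finite_degree_eq (m j : ℕ) : {b : Fin (m + 1) →₀ ℕ | b.degree = j}.Finite := by
  refine (Set.finite_Iic (Finsupp.equivFunOnFinite.symm fun _ => j)).subset fun b hb i => ?_
  exact (Finsupp.le_degree i b).trans (le_of_eq hb)

theorem grading_eq_restrictSupport (j : ℕ) :
    grading k m j = restrictSupport k {b | b.degree = j} := by
  rw [grading, homogeneousSubmodule_eq_finsupp_supported]
  rfl

theorem finrank_restrictSupport (s : Set (Fin (m + 1) →₀ ℕ)) :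
    Module.finrank k (restrictSupport k s) = s.ncard := by
  rw [Module.finrank_eq_nat_card_basis (basisRestrictSupport k s), Nat.card_coe_set_eq]

instance finite_grading (j : ℕ) : Module.Finite k (grading k m j) := by
  rw [grading_eq_restrictSupport]
  have := (finite_degree_eq m j).to_subtype
  exact Module.Finite.of_basis (basisRestrictSupport k _)

/-- The Hilbert function of `R / I` is complementary to that of `I`. -/
theorem hilbertFunction_add_finrank_component (I : Ideal (Poly k m)) (j : ℕ) :
    hilbertFunction I j + Module.finrank k (component I j) = Module.finrank k (grading k m j) := by
  have h := LinearMap.finrank_range_add_finrank_ker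
    ((Ideal.Quotient.mkₐ k I).toLinearMap.domRestrict (grading k m j))
  rw [LinearMap.range_domRestrict] at h
  rw [← h, hilbertFunction]
  congr 1
  have hmap : component I j = (LinearMap.ker ((Ideal.Quotient.mkₐ k I).toLinearMap.domRestrict
      (grading k m j))).map (grading k m j).subtype := by
    ext p
    simp only [component, Submodule.mem_inf, Submodule.restrictScalars_mem, Submodule.mem_map,
      LinearMap.mem_ker, LinearMap.domRestrict_apply, AlgHom.toLinearMap_apply,
      Ideal.Quotient.mkₐ_eq_mk, Ideal.Quotient.eq_zero_iff_mem, Submodule.subtype_apply]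
    constructor
    · rintro ⟨h1, h2⟩
      exact ⟨⟨p, h2⟩, h1, rfl⟩
    · rintro ⟨q, h1, rfl⟩
      exact ⟨h1, q.2⟩
  rw [hmap]
  exact Submodule.finrank_map_subtype_eq (grading k m j) _

theorem component_lexIdeal (D : Fin (m + 1) →₀ ℕ) (j : ℕ) :
    component (lexIdeal k D) j = restrictSupport k {b | b.degree = j ∧ toLex D ≤ toLex b} := by
  ext p
  rw [component, grading_eq_restrictSupport, Submodule.mem_inf, Submodule.restrictScalars_mem,
    mem_lexIdeal, mem_restrictSupport_iff, mem_restrictSupport_iff]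
  exact ⟨fun h b hb => ⟨h.2 hb, h.1 b hb⟩, fun h => ⟨fun b hb => (h hb).2, fun b hb => (h hb).1⟩⟩

/-- With `N` the size of the degree-`j` segment, a monomial in the segment has fewer than `N`
monomials above it, since it is not above itself; a monomial outside has the whole segment above it.
-/
theorem isLexicographic_lexIdeal (D : Fin (m + 1) →₀ ℕ) : IsLexicographic (lexIdeal k D) where
  monomial := ⟨_, rfl⟩
  largest j := by
    rw [component_lexIdeal, finrank_restrictSupport, restrictSupport_eq_span]
    congr 2
    have hfin : {b : Fin (m + 1) →₀ ℕ | b.degree = j ∧ toLex D ≤ toLex b}.Finite :=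
      (finite_degree_eq m j).subset fun b hb => hb.1
    ext b
    constructor
    · rintro ⟨hb, hDb⟩
      refine ⟨hb, Set.ncard_lt_ncard ⟨fun c hc => ⟨hc.1, hDb.trans hc.2.le⟩, fun h => ?_⟩ hfin⟩
      exact lt_irrefl _ (h ⟨hb, hDb⟩).2
    · rintro ⟨hb, hlt⟩
      refine ⟨hb, ?_⟩
      by_contra! hbD
      refine hlt.not_ge (Set.ncard_le_ncard (fun c hc => ⟨hc.1, hbD.trans_le hc.2⟩) ?_)
      exact (finite_degree_eq m j).subset fun c hc => hc.1

/-- The Hilbert function of `R / lexIdeal D` counts the monomials smaller than `x^D`. -/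
theorem hilbertFunction_lexIdeal (D : Fin (m + 1) →₀ ℕ) (j : ℕ) :
    hilbertFunction (lexIdeal k D) j =
      {b : Fin (m + 1) →₀ ℕ | b.degree = j ∧ toLex b < toLex D}.ncard := by
  have h := hilbertFunction_add_finrank_component (lexIdeal k D) j
  rw [component_lexIdeal, finrank_restrictSupport, grading_eq_restrictSupport,
    finrank_restrictSupport] at h
  have hsplit : {b : Fin (m + 1) →₀ ℕ | b.degree = j} =
      {b | b.degree = j ∧ toLex b < toLex D} ∪ {b | b.degree = j ∧ toLex D ≤ toLex b} := by
    ext b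
    have := lt_or_ge (toLex b) (toLex D)
    simp only [Set.mem_ofPred_eq, Set.mem_union]
    tauto
  rw [hsplit, Set.ncard_union_eq (Set.disjoint_left.2 fun b h1 h2 => h1.2.not_ge h2.2)
    ((finite_degree_eq m j).subset fun c hc => hc.1)
    ((finite_degree_eq m j).subset fun c hc => hc.1)] at h
  omega

/-- A monomial ideal is determined by the monomials in it, and each of these is seen in the
component of its own degree; hence equal components give equal ideals. -/
theorem mem_iff_of_isLexicographic {I : Ideal (Poly k m)} (hI : IsLexicographic I) (p : Poly k m) :
    p ∈ I ↔ ∀ b ∈ p.support, monomial b (1 : k) ∈ component I b.degree := by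
  have hb : ∀ b : Fin (m + 1) →₀ ℕ,
      monomial b (1 : k) ∈ component I b.degree ↔ monomial b (1 : k) ∈ I := fun b => by
    rw [component, Submodule.mem_inf, Submodule.restrictScalars_mem, mem_homogeneousSubmodule]
    exact and_iff_left (isHomogeneous_monomial _ rfl)
  simp only [hb]
  obtain ⟨S, rfl⟩ := hI.monomial
  rw [mem_ideal_span_monomial_image]
  refine forall₂_congr fun b _ => ?_
  classical
  rw [mem_ideal_span_monomial_image, support_monomial, if_neg one_ne_zero]
  simp

/-- A lexicographic ideal is determined by its Hilbert function. -/
theorem IsLexicographic.eq_of_hilbertFunction_eq {I J : Ideal (Poly k m)} (hI : IsLexicographic I)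
    (hJ : IsLexicographic J) (h : ∀ j, hilbertFunction I j = hilbertFunction J j) : I = J := by
  have hc : ∀ j, component I j = component J j := fun j => by
    have h1 := hilbertFunction_add_finrank_component I j
    have h2 := hilbertFunction_add_finrank_component J j
    rw [hI.largest, hJ.largest]
    rw [h j, ← h2] at h1
    rw [Nat.add_left_cancel h1]
  ext p
  rw [mem_iff_of_isLexicographic hI, mem_iff_of_isLexicographic hJ]
  simp only [hc]

/-- Monomials involving some `x_q` with `q < p` exceed `x_p^d x^D` automatically and give the linear
forms. The others can reach `x_p^d x^D` only if `x_p^d` divides them, and then `x_p^d` cancels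
because the order is translation invariant. -/
theorem lexIdeal_single_add {D : Fin (m + 1) →₀ ℕ} {p : Fin (m + 1)} {d : ℕ}
    (hD : ∀ r < p, D r = 0) :
    lexIdeal k (Finsupp.single p d + D) =
      Ideal.span (X '' Set.Iio p) ⊔ Ideal.span {X p ^ d} * lexIdeal k D := by
  have hE : ∀ r < p, (Finsupp.single p d + D) r = 0 := fun r hr => by
    rw [Finsupp.add_apply, hD r hr, Finsupp.single_eq_of_ne hr.ne]
  apply le_antisymm
  · rw [lexIdeal, Ideal.span_le]
    rintro _ ⟨b, hb, rfl⟩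
    by_cases hbp : ∃ q < p, b q ≠ 0
    · obtain ⟨q, hq, hbq⟩ := hbp
      refine Ideal.mem_sup_left (mem_ideal_span_X_image.2 fun c hc => ⟨q, hq, ?_⟩)
      classical
      rw [support_monomial, if_neg one_ne_zero, Finset.mem_singleton] at hc
      rwa [hc]
    · push Not at hbp
      have hd : d ≤ b p := by
        by_contra! hlt
        refine absurd hb (not_le.2 (toLex_lt_iff.2
          ⟨p, fun r hr => (hbp r hr).trans (hE r hr).symm, ?_⟩))
        exact hlt.trans_le (by simp)
      obtain ⟨c, rfl⟩ := exists_add_of_le (Finsupp.single_le_iff.2 hd)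
      have hc : toLex D ≤ toLex c := by
        have : toLex (Finsupp.single p d) + toLex D ≤ toLex (Finsupp.single p d) + toLex c := hb
        exact le_of_add_le_add_left this
      have hmul : monomial (Finsupp.single p d + c) (1 : k) = X p ^ d * monomial c 1 := by
        rw [X_pow_eq_monomial, monomial_mul, one_mul]
      refine Ideal.mem_sup_right ?_
      simp only [hmul]
      exact Ideal.mul_mem_mul (Ideal.mem_span_singleton_self _) (monomial_mem_lexIdeal hc)
  · refine sup_le (Ideal.span_le.2 ?_) (Ideal.mul_le.2 fun r hr s hs => ?_)
    · rintro _ ⟨q, hq, rfl⟩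
      refine monomial_mem_lexIdeal (toLex_lt_iff.2 ⟨q, fun r hr => ?_, ?_⟩).le
      · exact (hE r (hr.trans hq)).trans (Finsupp.single_eq_of_ne hr.ne).symm
      · rw [hE q hq, Finsupp.single_eq_same]
        exact one_pos
    · obtain ⟨t, rfl⟩ := Ideal.mem_span_singleton.1 hr
      rw [X_pow_eq_monomial, mul_assoc, mem_lexIdeal]
      intro b hb
      rw [mem_support_iff, coeff_monomial_mul'] at hb
      split_ifs at hb with hle
      · obtain ⟨c, rfl⟩ := exists_add_of_le hle
        rw [add_tsub_cancel_left, one_mul, ← mem_support_iff] at hb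
        exact add_le_add_right (mem_lexIdeal.1 (Ideal.mul_mem_left _ t hs) c hb)
          (toLex (Finsupp.single p d))
      · exact absurd rfl hb

end LexIdeal

/-! ### Existence and uniqueness of the ideal of a partition -/

section Partition

variable {k : Type u} [Field k] {m : ℕ}

/-- The monomials `x^b` with `x^D ≤ x^b < x^D x_q`, where `x^D` involves only `x₀, …, x_q`. -/
theorem le_and_lt_add_single_iff {D b : Fin (m + 1) →₀ ℕ} {q : Fin (m + 1)}
    (hD : ∀ r, q < r → D r = 0) :
    (toLex D ≤ toLex b ∧ toLex b < toLex (D + Finsupp.single q 1)) ↔ ∀ r ≤ q, b r = D r := by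
  constructor
  · rintro ⟨h1, i, hi, hlt⟩
    have hnlt : ∀ i, ¬((∀ j, j < i → b j = D j) ∧ b i < D i) := fun i hi =>
      h1.not_gt (toLex_lt_iff.2 ⟨i, hi⟩)
    replace hi : ∀ j < i, b j = D j + Finsupp.single q 1 j := hi
    replace hlt : b i < D i + Finsupp.single q 1 i := hlt
    have hi' : ∀ j, j < i → i ≤ q → b j = D j := fun j hj hiq => by
      have := hi j hj
      rwa [Finsupp.single_eq_of_ne (hj.trans_le hiq).ne, add_zero] at this
    -- At the first index `i` where `b` differs from `D + e_q`, `b` is smaller. If `i < q` this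
    -- would give `b < D`; if `i > q` the entry of `D` is `0` and nothing is smaller; so `i = q`,
    -- and `b ≥ D` forces equality with `D` up to `q`.
    rcases lt_trichotomy i q with h | rfl | h
    · rw [Finsupp.single_eq_of_ne h.ne, add_zero] at hlt
      exact absurd ⟨fun j hj => hi' j hj h.le, hlt⟩ (hnlt i)
    · rw [Finsupp.single_eq_same] at hlt
      intro r hr
      rcases hr.lt_or_eq with hr | rfl
      · exact hi' r hr le_rfl
      · by_contra hne
        exact hnlt r ⟨fun j hj => hi' j hj le_rfl, by omega⟩
    · rw [Finsupp.single_eq_of_ne h.ne', hD i h] at hlt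
      omega
  · intro h
    refine ⟨Finsupp.toLex_monotone fun r => ?_, toLex_lt_iff.2 ⟨q, fun j hj => ?_, ?_⟩⟩
    · rcases le_or_gt r q with hr | hr
      · exact (h r hr).ge
      · rw [hD r hr]; exact Nat.zero_le _
    · rw [Finsupp.add_apply, Finsupp.single_eq_of_ne hj.ne, add_zero, h j hj.le]
    · rw [Finsupp.add_apply, Finsupp.single_eq_same, h q le_rfl]
      exact Nat.lt_succ_self _

/-- The new monomials are those with the exponents of `D` up to `q`, that is, `x^D` times an
arbitrary monomial of degree `j - deg D` in the `m - q` variables after `x_q`. -/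
theorem ncard_lt_add_single {D : Fin (m + 1) →₀ ℕ} {q : Fin (m + 1)}
    (hD : ∀ r, q < r → D r = 0) (j : ℕ) :
    {b : Fin (m + 1) →₀ ℕ | b.degree = j ∧ toLex b < toLex (D + Finsupp.single q 1)}.ncard =
      {b : Fin (m + 1) →₀ ℕ | b.degree = j ∧ toLex b < toLex D}.ncard +
        if D.degree ≤ j then (m - q + (j - D.degree) - 1).choose (j - D.degree) else 0 := by
  have hsplit : {b : Fin (m + 1) →₀ ℕ | b.degree = j ∧ toLex b < toLex (D + Finsupp.single q 1)} =
      {b | b.degree = j ∧ toLex b < toLex D} ∪ {b | b.degree = j ∧ ∀ r ≤ q, b r = D r} := by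
    ext b
    simp only [← le_and_lt_add_single_iff hD, Set.mem_ofPred_eq, Set.mem_union]
    have h1 := lt_or_ge (toLex b) (toLex D)
    have h2 : toLex b < toLex D → toLex b < toLex (D + Finsupp.single q 1) := fun h =>
      h.trans_le (Finsupp.toLex_monotone le_self_add)
    tauto
  rw [hsplit, Set.ncard_union_eq (Set.disjoint_left.2 fun b h1 h2 =>
      h1.2.not_ge ((le_and_lt_add_single_iff hD).2 h2.2).1)
    ((finite_degree_eq m j).subset fun c hc => hc.1)
    ((finite_degree_eq m j).subset fun c hc => hc.1)]
  congr 1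
  have hdeg : ∀ b : Fin (m + 1) →₀ ℕ, (∀ r ≤ q, b r = D r) → D ≤ b := fun b hb r => by
    rcases le_or_gt r q with hr | hr
    · exact (hb r hr).ge
    · rw [hD r hr]; exact Nat.zero_le _
  split_ifs with hj
  · have himg : {b : Fin (m + 1) →₀ ℕ | b.degree = j ∧ ∀ r ≤ q, b r = D r} =
        (fun c => D + c) '' (Finset.finsuppAntidiag (Finset.Ioi q) (j - D.degree) :
          Set (Fin (m + 1) →₀ ℕ)) := by
      ext b
      simp only [Set.mem_ofPred_eq, Set.mem_image, Finset.mem_coe, Finset.mem_finsuppAntidiag']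
      constructor
      · rintro ⟨hb, h⟩
        obtain ⟨c, rfl⟩ := exists_add_of_le (hdeg b h)
        refine ⟨c, ⟨?_, fun r hr => ?_⟩, rfl⟩
        · rw [map_add] at hb
          change c.degree = _
          omega
        · by_contra hrq
          have := h r (not_lt.1 fun h => hrq (Finset.mem_Ioi.2 h))
          simp only [Finsupp.add_apply] at this
          exact Finsupp.mem_support_iff.1 hr (by omega)
      · rintro ⟨c, ⟨hc, hsupp⟩, rfl⟩
        change c.degree = _ at hc
        refine ⟨by rw [map_add, hc]; omega, fun r hr => ?_⟩
        have : c r = 0 := by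
          by_contra h0
          exact (Finset.mem_Ioi.1 (hsupp (Finsupp.mem_support_iff.2 h0))).not_ge hr
        rw [Finsupp.add_apply, this, add_zero]
    rw [himg, Set.ncard_image_of_injective _ (add_right_injective D), Set.ncard_coe_finset,
      Finset.card_finsuppAntidiag_nat_eq_choose, Fin.card_Ioi]
    congr 2
  · rw [Set.ncard_eq_zero ((finite_degree_eq m j).subset fun c hc => hc.1)]
    refine Set.eq_empty_of_forall_notMem fun b hb => hj ?_
    obtain ⟨c, rfl⟩ := exists_add_of_le (hdeg b hb.2)
    rw [← hb.1, map_add]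
    exact Nat.le_add_right _ _

/-- The index of the variable `x_{m - a}`. -/
def varIndex (m a : ℕ) : Fin (m + 1) := ⟨m - a, by omega⟩

/-- The exponent vector `∑ᵢ e_{m - lᵢ}` attached to a partition `l`. -/
def partExponent (m : ℕ) (l : List ℕ) : Fin (m + 1) →₀ ℕ :=
  (l.map fun a => Finsupp.single (varIndex m a) 1).sum

theorem partExponent_append (l l' : List ℕ) :
    partExponent m (l ++ l') = partExponent m l + partExponent m l' := by
  simp [partExponent]

theorem partExponent_replicate (d a : ℕ) :
    partExponent m (List.replicate d a) = Finsupp.single (varIndex m a) d := by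
  simp [partExponent]

theorem degree_partExponent (l : List ℕ) : (partExponent m l).degree = l.length := by
  induction l with
  | nil => simp [partExponent]
  | cons a l ih =>
    rw [← List.singleton_append, partExponent_append, map_add, ih]
    simp [partExponent, add_comm]

theorem partExponent_apply_eq_zero {l : List ℕ} {r : Fin (m + 1)}
    (h : ∀ a ∈ l, varIndex m a ≠ r) : partExponent m l r = 0 := by
  induction l with
  | nil => simp [partExponent]
  | cons a l ih =>
    rw [← List.singleton_append, partExponent_append, Finsupp.add_apply,
      ih fun b hb => h b (List.mem_cons_of_mem _ hb)]
    simp [partExponent, h a List.mem_cons_self]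

/-- Since the parts decrease, the indices `m - lᵢ` increase, so the monomial of the first `t` parts
involves no variable after the next one to be multiplied in. Each step therefore adds exactly one
block of `ncard_lt_add_single`. -/
theorem ncard_lt_partExponent {l : List ℕ} (hl : l.Pairwise (· ≥ ·)) (hpos : ∀ a ∈ l, 0 < a)
    (hle : ∀ a ∈ l, a ≤ m) (j t : ℕ) (ht : t ≤ l.length) :
    ({b : Fin (m + 1) →₀ ℕ | b.degree = j ∧
        toLex b < toLex (partExponent m (l.take t))}.ncard : ℤ) =
      ∑ i ∈ Finset.range t,
        binom ((j : ℤ) + (l.getD i 0 : ℕ) - ((i : ℤ) + 1)) ((j : ℤ) - ((i : ℤ) + 1) + 1) := by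
  induction t with
  | zero =>
    have : {b : Fin (m + 1) →₀ ℕ | b.degree = j ∧
        toLex b < toLex (partExponent m (l.take 0))} = ∅ := by
      refine Set.eq_empty_of_forall_notMem fun b hb => ?_
      have : toLex (0 : Fin (m + 1) →₀ ℕ) ≤ toLex b := Finsupp.toLex_monotone zero_le
      exact hb.2.not_ge this
    rw [this]
    simp
  | succ t ih =>
    have htl : t < l.length := ht
    have hmem : l[t] ∈ l := List.getElem_mem htl
    have htake : l.take (t + 1) = l.take t ++ [l[t]] := List.take_succ_eq_append_getElem htl
    have hsingle : partExponent m [l[t]] = Finsupp.single (varIndex m l[t]) 1 := by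
      simp [partExponent]
    have hD : ∀ r, varIndex m l[t] < r → partExponent m (l.take t) r = 0 := fun r hr => by
      refine partExponent_apply_eq_zero fun a ha hra => ?_
      obtain ⟨i, hi, rfl⟩ := List.mem_iff_getElem.1 ha
      rw [List.getElem_take] at hra
      have hit : i < t := (List.length_take ▸ hi).trans_le (min_le_left _ _)
      have := List.pairwise_iff_getElem.1 hl i t (hit.trans htl) htl hit
      rw [← hra, Fin.lt_def] at hr
      simp only [varIndex] at hr
      omega
    rw [htake, partExponent_append, hsingle, ncard_lt_add_single hD, Nat.cast_add,
      ih (Nat.le_of_succ_le ht), Finset.sum_range_succ, degree_partExponent,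
      List.length_take, min_eq_left htl.le]
    congr 1
    -- Positivity of the part keeps the truncated subtraction in `l[t] + (j - t) - 1` exact when `j
    -- = t`; the bound by `m` gives `m - (m - l[t]) = l[t]`.
    have h1 := hpos _ hmem
    have h2 := hle _ hmem
    rw [List.getD_eq_getElem _ _ htl, binom]
    split_ifs with h3 h4 h4
    · have e1 : (j : ℤ) + (l[t] : ℕ) - ((t : ℤ) + 1) = ((l[t] + (j - t) - 1 : ℕ) : ℤ) := by omega
      have e2 : ((j : ℤ) - ((t : ℤ) + 1) + 1).toNat = j - t := by omega
      have e3 : m - (varIndex m l[t] : ℕ) = l[t] := by simp only [varIndex]; omega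
      rw [e1, e2, e3, Ring.choose_natCast]
    · omega
    · omega
    · rfl

theorem isLexIdealOf_lexIdeal {l : List ℕ} (hl : l.Pairwise (· ≥ ·)) (hpos : ∀ a ∈ l, 0 < a)
    (hle : ∀ a ∈ l, a ≤ m) : IsLexIdealOf l (lexIdeal k (partExponent m l)) where
  lexicographic := isLexicographic_lexIdeal _
  hilbert j := by
    have := ncard_lt_partExponent hl hpos hle j l.length le_rfl
    rw [List.take_length] at this
    rw [hilbertFunction_lexIdeal, this, Finset.sum_range]
    exact Finset.sum_congr rfl fun i _ => by
      rw [List.getD_eq_getElem _ _ i.2]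
      rfl

theorem IsLexIdealOf.unique {l : List ℕ} {I J : Ideal (Poly k m)} (hI : IsLexIdealOf l I)
    (hJ : IsLexIdealOf l J) : I = J :=
  hI.lexicographic.eq_of_hilbertFunction_eq hJ.lexicographic fun j => by
    have := (hI.hilbert j).trans (hJ.hilbert j).symm
    exact_mod_cast this

end Partition

/-! ### Dehomogenization of homogeneous ideals -/

section Dehomogenization

open HomogeneousLocalization
open scoped Pointwise

variable {k : Type u} [Field k] {m : ℕ} {s : Poly k m}

/-- The degree-zero fraction `p / sⁿ`, where `s` is a linear form and `p` a form of degree `n`. -/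
def frac (hs : s ∈ grading k m 1) (n : ℕ) (p : Poly k m) (hp : p ∈ grading k m n) :
    Away (grading k m) s :=
  Away.mk (grading k m) hs n p (by rwa [smul_eq_mul, mul_one])

theorem val_frac (hs : s ∈ grading k m 1) (n : ℕ) (p : Poly k m) (hp : p ∈ grading k m n) :
    (frac hs n p hp).val = Localization.mk p (⟨s ^ n, n, rfl⟩ : Submonoid.powers s) := rfl

theorem frac_surjective (hs : s ∈ grading k m 1) (x : Away (grading k m) s) :
    ∃ n p hp, frac hs n p hp = x := by
  obtain ⟨n, p, hp, rfl⟩ := Away.mk_surjective (grading k m) hs x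
  exact ⟨n, p, by rwa [smul_eq_mul, mul_one] at hp, rfl⟩

theorem frac_add (hs : s ∈ grading k m 1) (n : ℕ) (p q : Poly k m) (hp : p ∈ grading k m n)
    (hq : q ∈ grading k m n) :
    frac hs n (p + q) (add_mem hp hq) = frac hs n p hp + frac hs n q hq := by
  apply val_injective
  rw [val_add, val_frac, val_frac, val_frac, Localization.add_mk_self]

theorem frac_zero (hs : s ∈ grading k m 1) (n : ℕ) : frac hs n 0 (zero_mem _) = 0 := by
  apply val_injective
  rw [val_zero, val_frac, Localization.mk_zero]

theorem frac_sum_mem (hs : s ∈ grading k m 1) {n : ℕ} {T : Ideal (Away (grading k m) s)}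
    {ι : Type*} {A : Finset ι} {f : ι → Poly k m}
    (hf : ∀ i ∈ A, ∃ h : f i ∈ grading k m n, frac hs n (f i) h ∈ T) :
    ∃ h : ∑ i ∈ A, f i ∈ grading k m n, frac hs n (∑ i ∈ A, f i) h ∈ T := by
  classical
  induction A using Finset.induction_on with
  | empty =>
    refine ⟨zero_mem _, ?_⟩
    simp only [Finset.sum_empty]
    rw [frac_zero]
    exact zero_mem _
  | insert a A ha ih =>
    obtain ⟨h1, h1'⟩ := hf a (Finset.mem_insert_self a A)
    obtain ⟨h2, h2'⟩ := ih fun i hi => hf i (Finset.mem_insert_of_mem hi)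
    simp only [Finset.sum_insert ha]
    refine ⟨add_mem h1 h2, ?_⟩
    rw [frac_add hs _ _ _ h1 h2]
    exact add_mem h1' h2'

theorem frac_mul (hs : s ∈ grading k m 1) {n n' : ℕ} {p q : Poly k m} (hp : p ∈ grading k m n)
    (hq : q ∈ grading k m n') :
    frac hs (n + n') (p * q) (SetLike.mul_mem_graded hp hq) = frac hs n p hp * frac hs n' q hq := by
  apply val_injective
  rw [val_mul, val_frac, val_frac, val_frac, Localization.mk_mul]
  congr 1
  exact Subtype.ext (pow_add s n n')

theorem frac_pow_self (hs : s ∈ grading k m 1) (n : ℕ) (h : s ^ n ∈ grading k m n) :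
    frac hs n (s ^ n) h = 1 := by
  apply val_injective
  rw [val_one, val_frac]
  exact Localization.mk_self (⟨s ^ n, n, rfl⟩ : Submonoid.powers s)

theorem pow_mem_grading (hs : s ∈ grading k m 1) (n : ℕ) : s ^ n ∈ grading k m n := by
  simpa using SetLike.pow_mem_graded n hs

theorem frac_congr (hs : s ∈ grading k m 1) {n n' : ℕ} {p q : Poly k m} (hp : p ∈ grading k m n)
    (hq : q ∈ grading k m n') (hn : n = n') (h : p = q) : frac hs n p hp = frac hs n' q hq := by
  subst hn h
  rfl

theorem frac_pow_mul (hs : s ∈ grading k m 1) {n N : ℕ} {p : Poly k m} (hp : p ∈ grading k m n)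
    (h : s ^ N * p ∈ grading k m (N + n)) :
    frac hs (N + n) (s ^ N * p) h = frac hs n p hp := by
  rw [frac_mul hs (pow_mem_grading hs N) hp, frac_pow_self, one_mul]

/-- The degree-zero part of the extension of `I` to `R_s`. -/
def awayIdeal (I : Ideal (Poly k m)) (s : Poly k m) : Ideal (Away (grading k m) s) :=
  (I.map (algebraMap (Poly k m) (Localization.Away s))).comap
    (algebraMap (Away (grading k m) s) (Localization.Away s))

theorem frac_mem_awayIdeal (hs : s ∈ grading k m 1) {I : Ideal (Poly k m)} {n : ℕ} {p : Poly k m}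
    (hp : p ∈ grading k m n) :
    frac hs n p hp ∈ awayIdeal I s ↔ ∃ N, s ^ N * p ∈ I := by
  change (frac hs n p hp).val ∈ I.map (algebraMap (Poly k m) (Localization.Away s)) ↔ _
  rw [val_frac, Localization.mk_eq_mk', IsLocalization.mk'_mem_map_algebraMap_iff]
  constructor
  · rintro ⟨_, ⟨N, rfl⟩, h⟩
    exact ⟨N, h⟩
  · rintro ⟨N, h⟩
    exact ⟨_, ⟨N, rfl⟩, h⟩

/-- The fractions `p / s^(deg p)` for `p` in a set of forms. -/
def fracSet (hs : s ∈ grading k m 1) (S : Set (Poly k m)) : Set (Away (grading k m) s) :=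
  {x | ∃ n p, ∃ hp : p ∈ grading k m n, p ∈ S ∧ frac hs n p hp = x}

/-- Dehomogenizing generators gives generators. -/
theorem awayIdeal_span (hs : s ∈ grading k m 1) {S : Set (Poly k m)}
    (hS : ∀ p ∈ S, ∃ n, p ∈ grading k m n) :
    awayIdeal (Ideal.span S) s = Ideal.span (fracSet hs S) := by
  apply le_antisymm
  -- The claim is made for every homogeneous component of `y` at once, because multiplying by an
  -- inhomogeneous scalar mixes degrees.
  · have key : ∀ y ∈ Ideal.span S, ∀ n,
        frac hs n (DirectSum.decompose (grading k m) y n) (SetLike.coe_mem _) ∈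
          Ideal.span (fracSet hs S) := by
      intro y hy
      induction hy using Submodule.span_induction with
      | zero =>
        intro n
        rw [frac_congr hs _ (zero_mem _) rfl (by simp), frac_zero]
        exact zero_mem _
      | mem p hp =>
        intro n
        obtain ⟨a, ha⟩ := hS p hp
        by_cases h : a = n
        · subst h
          rw [frac_congr hs _ ha rfl (DirectSum.decompose_of_mem_same _ ha)]
          exact Ideal.subset_span ⟨a, p, ha, hp, rfl⟩
        · rw [frac_congr hs _ (zero_mem _) rfl (DirectSum.decompose_of_mem_ne _ ha h), frac_zero]
          exact zero_mem _
      | add y z _ _ hy hz =>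
        intro n
        rw [frac_congr hs _ (add_mem (SetLike.coe_mem _) (SetLike.coe_mem _)) rfl
          (show _ = (DirectSum.decompose (grading k m) y n : Poly k m) +
            (DirectSum.decompose (grading k m) z n : Poly k m) by simp),
          frac_add hs _ _ _ (SetLike.coe_mem _) (SetLike.coe_mem _)]
        exact add_mem (hy n) (hz n)
      | smul a y _ hy =>
        intro n
        have hsum : (DirectSum.decompose (grading k m) (a • y) n : Poly k m) =
            ∑ ij ∈ Finset.HasAntidiagonal.antidiagonal n,
              (DirectSum.decompose (grading k m) a ij.1 : Poly k m) *
              DirectSum.decompose (grading k m) y ij.2 := by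
          rw [smul_eq_mul, DirectSum.decompose_mul, DirectSum.coe_mul_apply_eq_sum_antidiagonal]
        obtain ⟨h, hmem⟩ := frac_sum_mem hs (n := n) (T := Ideal.span (fracSet hs S))
          (A := Finset.HasAntidiagonal.antidiagonal n) (f := fun ij =>
            (DirectSum.decompose (grading k m) a ij.1 : Poly k m) *
              DirectSum.decompose (grading k m) y ij.2) (by
            rintro ⟨i, j⟩ hij
            rw [Finset.HasAntidiagonal.mem_antidiagonal] at hij
            subst hij
            refine ⟨SetLike.mul_mem_graded (SetLike.coe_mem _) (SetLike.coe_mem _), ?_⟩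
            rw [frac_mul hs (SetLike.coe_mem _) (SetLike.coe_mem _)]
            exact Ideal.mul_mem_left _ _ (hy j))
        rwa [frac_congr hs _ h rfl hsum]
    intro x hx
    obtain ⟨n, p, hp, rfl⟩ := frac_surjective hs x
    obtain ⟨N, hN⟩ := (frac_mem_awayIdeal hs hp).1 hx
    have hmem := SetLike.mul_mem_graded (pow_mem_grading hs N) hp
    have := key _ hN (N + n)
    rwa [frac_congr hs _ hmem rfl (DirectSum.decompose_of_mem_same _ hmem), frac_pow_mul hs hp] at this
  · rw [Ideal.span_le]
    rintro _ ⟨n, p, hp, hpS, rfl⟩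
    exact (frac_mem_awayIdeal hs hp).2 ⟨0, by simpa using Ideal.subset_span hpS⟩

theorem frac_eq_frac (hs : s ∈ grading k m 1) {n n' : ℕ} {p : Poly k m} (hp : p ∈ grading k m n)
    (hp' : p ∈ grading k m n') : frac hs n p hp = frac hs n' p hp' := by
  by_cases h : n = n'
  · exact frac_congr hs hp hp' h rfl
  · have h0 : p = 0 := by
      by_contra hne
      exact h (MvPolynomial.IsHomogeneous.inj_right hp hp' hne)
    rw [frac_congr hs hp (zero_mem _) rfl h0, frac_congr hs hp' (zero_mem _) rfl h0, frac_zero,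
      frac_zero]

theorem awayIdeal_mono {I J : Ideal (Poly k m)} (h : I ≤ J) (s : Poly k m) :
    awayIdeal I s ≤ awayIdeal J s :=
  Ideal.comap_mono (Ideal.map_mono h)

theorem awayIdeal_top (s : Poly k m) : awayIdeal (⊤ : Ideal (Poly k m)) s = ⊤ := by
  rw [awayIdeal, Ideal.map_top, Ideal.comap_top]

theorem awayIdeal_eq_top_of_mem {I : Ideal (Poly k m)} (hs : s ∈ I) : awayIdeal I s = ⊤ := by
  have : I.map (algebraMap (Poly k m) (Localization.Away s)) = ⊤ :=
    Ideal.eq_top_of_isUnit_mem _ (Ideal.mem_map_of_mem _ hs)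
      (IsLocalization.Away.algebraMap_isUnit s)
  rw [awayIdeal, this, Ideal.comap_top]

theorem exists_eq_span {I : Ideal (Poly k m)} (hI : I.IsHomogeneous (grading k m)) :
    ∃ S : Set (Poly k m), (∀ p ∈ S, ∃ n, p ∈ grading k m n) ∧ I = Ideal.span S := by
  obtain ⟨S, rfl⟩ := (Ideal.IsHomogeneous.iff_exists (𝒜 := grading k m) I).1 hI
  refine ⟨_, ?_, rfl⟩
  rintro _ ⟨p, -, rfl⟩
  exact p.2

theorem awayIdeal_singleton_mul (hs : s ∈ grading k m 1) {I : Ideal (Poly k m)}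
    (hI : I.IsHomogeneous (grading k m)) {d : ℕ} {g : Poly k m} (hg : g ∈ grading k m d) :
    awayIdeal (Ideal.span {g} * I) s = Ideal.span {frac hs d g hg} * awayIdeal I s := by
  obtain ⟨S, hS, rfl⟩ := exists_eq_span hI
  have hgS : ∀ p ∈ ({g} : Set (Poly k m)) * S, ∃ n, p ∈ grading k m n := by
    rintro _ ⟨_, rfl, p, hp, rfl⟩
    obtain ⟨n, hn⟩ := hS p hp
    exact ⟨d + n, SetLike.mul_mem_graded hg hn⟩
  rw [Ideal.span_mul_span', awayIdeal_span hs hgS, awayIdeal_span hs hS, Ideal.span_mul_span']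
  congr 1
  ext x
  constructor
  · rintro ⟨n, _, hq, ⟨_, rfl, p, hp, rfl⟩, rfl⟩
    obtain ⟨a, ha⟩ := hS p hp
    refine ⟨_, rfl, _, ⟨a, p, ha, hp, rfl⟩, ?_⟩
    exact (frac_mul hs hg ha).symm.trans (frac_eq_frac hs _ _)
  · rintro ⟨_, rfl, _, ⟨a, p, ha, hp, rfl⟩, rfl⟩
    exact ⟨d + a, g * p, SetLike.mul_mem_graded hg ha, ⟨g, rfl, p, hp, rfl⟩, frac_mul hs hg ha⟩

theorem awayIdeal_singleton (hs : s ∈ grading k m 1) {d : ℕ} {g : Poly k m}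
    (hg : g ∈ grading k m d) : awayIdeal (Ideal.span {g}) s = Ideal.span {frac hs d g hg} := by
  have := awayIdeal_singleton_mul hs (Ideal.IsHomogeneous.top (grading k m)) hg
  rwa [awayIdeal_top, Ideal.mul_top, Ideal.mul_top] at this

/-- Dehomogenization commutes with extension along homomorphisms of graded rings. -/
theorem map_awayIdeal {K : Type u} [Field K] {n : ℕ} (f : grading k m →+*ᵍ grading K n)
    (hs : s ∈ grading k m 1) {I : Ideal (Poly k m)} (hI : I.IsHomogeneous (grading k m)) :
    (awayIdeal I s).map (Away.map f s) = awayIdeal (I.map f) (f s) := by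
  obtain ⟨S, hS, rfl⟩ := exists_eq_span hI
  have hfS : ∀ p ∈ f '' S, ∃ a, p ∈ grading K n a := by
    rintro _ ⟨p, hp, rfl⟩
    obtain ⟨a, ha⟩ := hS p hp
    exact ⟨a, GradedFunLike.map_mem f ha⟩
  have hfrac : ∀ a p (hp : p ∈ grading k m a),
      Away.map f s (frac hs a p hp) = frac (GradedFunLike.map_mem f hs) a (f p) (GradedFunLike.map_mem f hp) := fun a p hp =>
    Away.map_mk ..
  rw [awayIdeal_span hs hS, Ideal.map_span f, awayIdeal_span (GradedFunLike.map_mem f hs) hfS, Ideal.map_span]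
  congr 1
  ext x
  constructor
  · rintro ⟨_, ⟨a, p, ha, hp, rfl⟩, rfl⟩
    exact ⟨a, f p, GradedFunLike.map_mem f ha, ⟨p, hp, rfl⟩, (hfrac a p ha).symm⟩
  · rintro ⟨a, _, hq, ⟨p, hp, rfl⟩, rfl⟩
    obtain ⟨b, hb⟩ := hS p hp
    exact ⟨_, ⟨b, p, hb, hp, rfl⟩, (hfrac b p hb).trans (frac_eq_frac _ _ _)⟩

/-- If `f p / (f s)^a` vanishes, then `f` kills some `s^N p`, so `s^N p` lies in `I` and `p / s^a`
in its dehomogenization. -/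
theorem ker_awayMap_le {K : Type u} [Field K] {n : ℕ} (f : grading k m →+*ᵍ grading K n)
    (hs : s ∈ grading k m 1) {I : Ideal (Poly k m)} (hI : ∀ p, f p = 0 → p ∈ I) :
    RingHom.ker (Away.map f s) ≤ awayIdeal I s := by
  intro x hx
  obtain ⟨a, p, hp, rfl⟩ := frac_surjective hs x
  have h0 : frac (GradedFunLike.map_mem f hs) a (f p) (GradedFunLike.map_mem f hp) = 0 := (Away.map_mk ..).symm.trans hx
  have hmem : frac (GradedFunLike.map_mem f hs) a (f p) (GradedFunLike.map_mem f hp) ∈ awayIdeal ⊥ (f s) := by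
    rw [h0]
    exact zero_mem _
  obtain ⟨N, hN⟩ := (frac_mem_awayIdeal _ _).1 hmem
  rw [frac_mem_awayIdeal]
  refine ⟨N, hI _ ?_⟩
  rw [map_mul, map_pow]
  exact hN

/-- On the overlap of two charts, the dehomogenizations of a homogeneous ideal agree. -/
theorem map_awayMap_awayIdeal_le {t x : Poly k m} (hs : s ∈ grading k m 1)
    (ht : t ∈ grading k m 1) (hx : x = s * t) {I : Ideal (Poly k m)}
    (hI : I.IsHomogeneous (grading k m)) :
    (awayIdeal I t).map (awayMap (grading k m) hs (hx.trans (mul_comm s t))) ≤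
      (awayIdeal I s).map (awayMap (grading k m) ht hx) := by
  obtain ⟨S, hS, rfl⟩ := exists_eq_span hI
  rw [awayIdeal_span ht hS, Ideal.map_span, Ideal.span_le]
  rintro _ ⟨_, ⟨n, p, hn, hp, rfl⟩, rfl⟩
  -- On the overlap, `p / t^n = (p / s^n) · (s / t)^n`.
  have heq : awayMap (grading k m) hs (hx.trans (mul_comm s t)) (frac ht n p hn) =
      awayMap (grading k m) ht hx (frac hs n p hn) *
        awayMap (grading k m) hs (hx.trans (mul_comm s t)) (frac ht 1 s hs) ^ n := by
    apply val_injective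
    rw [val_mul, val_pow, frac, frac, frac, awayMap_mk, awayMap_mk, awayMap_mk, Away.val_mk,
      Away.val_mk, Away.val_mk, Localization.mk_pow, Localization.mk_mul, Localization.mk_eq_mk_iff,
      Localization.r_iff_exists]
    refine ⟨1, ?_⟩
    subst hx
    simp only [OneMemClass.coe_one, one_mul, Submonoid.coe_mul, SubmonoidClass.mk_pow]
    ring
  rw [heq]
  refine Ideal.mul_mem_right _ _ (Ideal.mem_map_of_mem _ ?_)
  exact (frac_mem_awayIdeal hs hn).2 ⟨0, by simpa using Ideal.subset_span hp⟩

end Dehomogenization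

/-! ### Ideal sheaves on affine schemes -/

section Affine

open Scheme.IdealSheafData

variable {A B : Type u} [CommRing A] [CommRing B]

theorem bijective_ΓSpecIso_inv (A : Type u) [CommRing A] :
    Function.Bijective (Scheme.ΓSpecIso (.of A)).inv.hom :=
  ConcreteCategory.bijective_of_isIso (Scheme.ΓSpecIso (.of A)).inv

theorem ideal_top_specIdealSheaf (I : Ideal A) :
    (specIdealSheaf I).ideal ⟨⊤, isAffineOpen_top _⟩ =
      I.map (Scheme.ΓSpecIso (.of A)).inv.hom :=
  equivOfIsAffine.right_inv _

theorem specIdealSheaf_le_iff {I J : Ideal A} : specIdealSheaf I ≤ specIdealSheaf J ↔ I ≤ J := by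
  rw [specIdealSheaf, specIdealSheaf, ← equivOfIsAffine_symm_apply, ← equivOfIsAffine_symm_apply]
  refine equivOfIsAffine.symm.toOrderIso.le_iff_le.trans ⟨fun h => ?_, Ideal.map_mono⟩
  have := Ideal.comap_mono (f := (Scheme.ΓSpecIso (.of A)).inv.hom) h
  rwa [Ideal.comap_map_of_bijective _ (bijective_ΓSpecIso_inv A),
    Ideal.comap_map_of_bijective _ (bijective_ΓSpecIso_inv A)] at this

theorem specIdealSheaf_surjective (T : (Spec (.of A)).IdealSheafData) :
    ∃ I : Ideal A, specIdealSheaf I = T := by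
  refine ⟨(T.ideal ⟨⊤, isAffineOpen_top _⟩).comap (Scheme.ΓSpecIso (.of A)).inv.hom, ?_⟩
  rw [specIdealSheaf, Ideal.map_comap_of_surjective _ (bijective_ΓSpecIso_inv A).2]
  exact equivOfIsAffine.left_inv T

theorem ker_SpecMap (φ : A →+* B) :
    (Spec.map (CommRingCat.ofHom φ)).ker = specIdealSheaf (RingHom.ker φ) := by
  rw [Scheme.ker_of_isAffine, specIdealSheaf]
  congr 1
  have h := congr(($(Scheme.ΓSpecIso_inv_naturality (CommRingCat.ofHom φ))).hom)
  rw [CommRingCat.hom_comp, CommRingCat.hom_comp, CommRingCat.hom_ofHom] at h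
  have hker : RingHom.ker φ = (RingHom.ker (Spec.map (CommRingCat.ofHom φ)).appTop.hom).comap
      (Scheme.ΓSpecIso (.of A)).inv.hom := by
    rw [RingHom.comap_ker, ← h]
    ext x
    simp only [RingHom.mem_ker, RingHom.comp_apply]
    exact (map_eq_zero_iff _ (bijective_ΓSpecIso_inv B).1).symm
  rw [hker, Ideal.map_comap_of_surjective _ (bijective_ΓSpecIso_inv A).2]

/-- An ideal is the kernel of its quotient map, so its sheaf is the kernel of a morphism of spectra,
and pushing forward a kernel gives the kernel of the composite. -/
theorem map_specIdealSheaf (φ : A →+* B) (I : Ideal B) :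
    (specIdealSheaf I).map (Spec.map (CommRingCat.ofHom φ)) = specIdealSheaf (I.comap φ) := by
  rw [← Ideal.mk_ker (I := I), ← ker_SpecMap, map_ker, ← Spec.map_comp, RingHom.comap_ker,
    ← ker_SpecMap]
  rfl

theorem comap_specIdealSheaf (φ : A →+* B) (I : Ideal A) :
    (specIdealSheaf I).comap (Spec.map (CommRingCat.ofHom φ)) = specIdealSheaf (I.map φ) := by
  refine eq_of_forall_ge_iff fun T => ?_
  obtain ⟨J, rfl⟩ := specIdealSheaf_surjective T
  rw [← le_map_iff_comap_le, map_specIdealSheaf, specIdealSheaf_le_iff, specIdealSheaf_le_iff,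
    Ideal.map_le_iff_le_comap]

end Affine

/-! ### Ideal sheaves and open immersions -/

section OpenImmersion

open Scheme.IdealSheafData Limits

/-- Flat base change for the pushforward of ideal sheaves, along an open immersion. -/
theorem comap_map_of_isPullback {W U V P : Scheme.{u}} {p : W ⟶ U} {q : W ⟶ V} {f : U ⟶ P}
    {g : V ⟶ P} (H : IsPullback p q f g) [IsOpenImmersion g] [QuasiCompact f]
    (I : U.IdealSheafData) : (I.map f).comap g = (I.comap p).map q := by
  -- An ideal sheaf is the kernel of the inclusion of its subscheme, so its pushforward is the
  -- kernel of a composite, and such kernels restrict along the open immersion `g`.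
  have h := Scheme.ker_ideal_of_isPullback_of_isOpenImmersion (I.subschemeι ≫ f) _ _ g
    ((IsPullback.of_hasPullback p I.subschemeι).paste_horiz H.flip)
  rw [← map_ker] at h
  refine Scheme.IdealSheafData.ext (funext fun T => ?_)
  rw [ideal_comap_of_isOpenImmersion]
  exact (h T).symm

variable {A : Type u} [CommRing A] {P : Scheme.{u}}

/-- The affine open subscheme that is the image of an affine chart. -/
def chartOpen (f : Spec (.of A) ⟶ P) [IsOpenImmersion f] : P.affineOpens :=
  ⟨f ''ᵁ ⊤, (isAffineOpen_top _).image_of_isOpenImmersion f⟩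

/-- Sections over the image of an affine chart. -/
def chartSections (f : Spec (.of A) ⟶ P) [IsOpenImmersion f] : A ≃+* Γ(P, chartOpen f) :=
  ((Scheme.ΓSpecIso (.of A)).symm ≪≫ (f.appIso ⊤).symm).commRingCatIsoToRingEquiv

theorem comap_eq_specIdealSheaf (T : P.IdealSheafData) (f : Spec (.of A) ⟶ P)
    [IsOpenImmersion f] :
    T.comap f = specIdealSheaf ((T.ideal (chartOpen f)).comap (chartSections f)) := by
  refine ext_of_isAffine ?_
  rw [ideal_top_specIdealSheaf, ideal_comap_of_isOpenImmersion]
  exact (Ideal.map_comap_of_surjective _ (bijective_ΓSpecIso_inv A).2 _).symm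

/-- The ideal of `A` given by the restriction of an ideal sheaf to the chart `f : Spec A ⟶ P`. -/
def chartRestrict (T : P.IdealSheafData) (f : Spec (.of A) ⟶ P) [IsOpenImmersion f] : Ideal A :=
  (T.ideal (chartOpen f)).comap (chartSections f)

theorem comap_eq_specIdealSheaf_iff {T : P.IdealSheafData} {f : Spec (.of A) ⟶ P}
    [IsOpenImmersion f] {I : Ideal A} :
    T.comap f = specIdealSheaf I ↔ chartRestrict T f = I := by
  rw [comap_eq_specIdealSheaf, ← chartRestrict]
  refine ⟨fun h => le_antisymm ?_ ?_, fun h => h ▸ rfl⟩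
  · exact specIdealSheaf_le_iff.1 h.le
  · exact specIdealSheaf_le_iff.1 h.ge

theorem chartRestrict_mul (S T : P.IdealSheafData) (f : Spec (.of A) ⟶ P) [IsOpenImmersion f] :
    chartRestrict (S * T) f = chartRestrict S f * chartRestrict T f := by
  simp only [chartRestrict, ideal_mul, Pi.mul_apply, ← Ideal.map_symm]
  exact Ideal.map_mul _ _ _

/-- Inclusions of ideal sheaves can be checked on charts. -/
theorem le_iff_chartRestrict_le {ι : Type*} {R : ι → Type u} [∀ i, CommRing (R i)]
    (f : ∀ i, Spec (.of (R i)) ⟶ P) [∀ i, IsOpenImmersion (f i)]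
    (hf : ⨆ i, (f i).opensRange = ⊤) {S T : P.IdealSheafData} :
    S ≤ T ↔ ∀ i, chartRestrict S (f i) ≤ chartRestrict T (f i) := by
  refine ⟨fun h i => Ideal.comap_mono (h _), fun h => ?_⟩
  refine le_of_iSup_eq_top (fun i => chartOpen (f i)) ?_ fun i => ?_
  · simpa [chartOpen, Scheme.Hom.image_top_eq_opensRange] using hf
  · have := Ideal.map_mono (f := (chartSections (f i) : R i →+* Γ(P, chartOpen (f i)))) (h i)
    have hs : Function.Surjective (chartSections (f i) : R i →+* Γ(P, chartOpen (f i))) :=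
      (chartSections (f i)).surjective
    exact (Ideal.map_comap_of_surjective _ hs _).ge.trans
      (this.trans (Ideal.map_comap_of_surjective _ hs _).le)

end OpenImmersion

/-! ### Closed subschemes of projective space on the standard charts -/

section Charts

open Scheme.IdealSheafData Limits HomogeneousLocalization MvPolynomial

variable {k : Type u} [Field k] {m : ℕ}

instance isOpenImmersion_chart (i : Fin (m + 1)) : IsOpenImmersion (chart k i) :=
  inferInstanceAs (IsOpenImmersion (Proj.awayι _ _ _ _))

theorem iSup_opensRange_chart (k : Type u) [Field k] (m : ℕ) :
    ⨆ i : Fin (m + 1), (chart k i).opensRange = ⊤ := by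
  refine Eq.trans (iSup_congr fun i => ?_) (Proj.iSup_basicOpen_eq_top (grading k m)
    (fun i : Fin (m + 1) => (X i : Poly k m))
    (irrelevant_le_of_X_mem fun i => Ideal.subset_span ⟨i, rfl⟩))
  exact Proj.opensRange_awayι ..

theorem isPullback_chart (i j : Fin (m + 1)) :
    IsPullback
      (Spec.map (CommRingCat.ofHom (awayMap (grading k m) (X_mem_grading k j)
        (rfl : (X i * X j : Poly k m) = _))))
      (Spec.map (CommRingCat.ofHom (awayMap (grading k m) (X_mem_grading k i)
        ((rfl : (X i * X j : Poly k m) = _).trans (mul_comm _ _)))))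
      (chart k i) (chart k j) := by
  refine IsPullback.of_iso_pullback ⟨?_⟩ (Proj.pullbackAwayιIso (grading k m) (X_mem_grading k i)
    one_pos (X_mem_grading k j) one_pos rfl).symm ?_ ?_
  · exact (Proj.SpecMap_awayMap_awayι ..).trans (Proj.SpecMap_awayMap_awayι ..).symm
  · exact Proj.pullbackAwayιIso_inv_fst ..
  · exact Proj.pullbackAwayιIso_inv_snd (hx := rfl) ..

/-- One inclusion is adjunction for the `j`-th term of the infimum. For the other, base change
reduces the `i`-th term to the overlap of the charts `i` and `j`, where the two dehomogenizations of
a homogeneous ideal agree. -/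
theorem chartRestrict_closedSubscheme {I : Ideal (Poly k m)} (hI : I.IsHomogeneous (grading k m))
    (j : Fin (m + 1)) : chartRestrict (closedSubscheme I) (chart k j) = chartIdeal I j := by
  apply le_antisymm
  · rw [← specIdealSheaf_le_iff, ← comap_eq_specIdealSheaf_iff.2 rfl, ← le_map_iff_comap_le]
    exact iInf_le _ j
  · have hle : ∀ i, chartIdeal I j ≤ chartRestrict ((specIdealSheaf (chartIdeal I i)).map
        (chart k i)) (chart k j) := fun i => by
      rw [← specIdealSheaf_le_iff, ← comap_eq_specIdealSheaf_iff.2 rfl,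
        comap_map_of_isPullback (isPullback_chart i j), comap_specIdealSheaf, map_specIdealSheaf,
        specIdealSheaf_le_iff, ← Ideal.map_le_iff_le_comap]
      exact map_awayMap_awayIdeal_le _ _ _ hI
    rw [closedSubscheme, chartRestrict, ideal_iInf, iInf_apply, Ideal.comap_iInf]
    exact le_iInf hle

theorem comap_chart_closedSubscheme {I : Ideal (Poly k m)} (hI : I.IsHomogeneous (grading k m))
    (j : Fin (m + 1)) :
    (closedSubscheme I).comap (chart k j) = specIdealSheaf (chartIdeal I j) :=
  comap_eq_specIdealSheaf_iff.2 (chartRestrict_closedSubscheme hI j)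

theorem le_iff_forall_chart {S T : (ProjSpace k m).IdealSheafData} :
    S ≤ T ↔ ∀ i, chartRestrict S (chart k i) ≤ chartRestrict T (chart k i) :=
  le_iff_chartRestrict_le _ (iSup_opensRange_chart k m)

theorem closedSubscheme_mono {I J : Ideal (Poly k m)} (h : I ≤ J) :
    closedSubscheme I ≤ closedSubscheme J :=
  iInf_mono fun i => map_mono _ (specIdealSheaf_le_iff.2 (awayIdeal_mono h (X i)))

theorem closedSubscheme_top : closedSubscheme (⊤ : Ideal (Poly k m)) = ⊤ := by
  refine top_le_iff.1 (le_iff_forall_chart.2 fun i => ?_)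
  rw [chartRestrict_closedSubscheme (Ideal.IsHomogeneous.top _)]
  exact le_top.trans (awayIdeal_top (X i)).ge

theorem isHomogeneous_map {K : Type u} [Field K] {n : ℕ} (f : grading k m →+*ᵍ grading K n)
    {I : Ideal (Poly k m)} (hI : I.IsHomogeneous (grading k m)) :
    (I.map f).IsHomogeneous (grading K n) :=
  (HomogeneousIdeal.map f ⟨I, hI⟩).2

/-! ### Pullbacks and kernels for the morphisms of `Proj` induced by graded homomorphisms. -/

section Functoriality

variable {K : Type u} [Field K] {n : ℕ} (f : grading k m →+*ᵍ grading K n)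
  (hf : HomogeneousIdeal.irrelevant (grading K n) ≤
    (HomogeneousIdeal.irrelevant (grading k m)).map f)

/-- On the chart `D₊(f xᵢ)` the morphism factors through `D₊(xᵢ)`, as the morphism of affine schemes
given by `Away.map f`, where pullback is extension of ideals. -/
theorem comap_awayι_comap_map {I : Ideal (Poly k m)} (hI : I.IsHomogeneous (grading k m))
    {t : Poly K n} (ht : t ∈ grading K n 1) {i : Fin (m + 1)} (hi : f (X i) = t) :
    ((closedSubscheme I).comap (Proj.map f hf)).comap (Proj.awayι (grading K n) t ht one_pos) =
      specIdealSheaf (awayIdeal (I.map f) t) := by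
  subst hi
  rw [← comap_comp, Proj.awayι_comp_map f hf one_pos (X i) (X_mem_grading k i), comap_comp]
  refine (congrArg (fun T => T.comap (Spec.map (CommRingCat.ofHom (Away.map f (X i)))))
    (comap_chart_closedSubscheme hI i)).trans ?_
  rw [comap_specIdealSheaf, ← map_awayIdeal f (X_mem_grading k i) hI]
  rfl

/-- Pullback along the morphism of projective spaces attached to a homomorphism of graded rings. -/
theorem comap_map_closedSubscheme {I : Ideal (Poly k m)} (hI : I.IsHomogeneous (grading k m))
    (hX : ∀ j, ∃ i, f (X i) = X j) :
    (closedSubscheme I).comap (Proj.map f hf) = closedSubscheme (I.map f) := by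
  have h : ∀ j, chartRestrict ((closedSubscheme I).comap (Proj.map f hf)) (chart K j) =
      chartRestrict (closedSubscheme (I.map f)) (chart K j) := fun j => by
    obtain ⟨i, hi⟩ := hX j
    rw [chartRestrict_closedSubscheme (isHomogeneous_map f hI)]
    exact comap_eq_specIdealSheaf_iff.1 (comap_awayι_comap_map f hf hI (X_mem_grading K j) hi)
  exact le_antisymm (le_iff_forall_chart.2 fun j => (h j).le)
    (le_iff_forall_chart.2 fun j => (h j).ge)

theorem ker_map_le_map_awayι {I : Ideal (Poly k m)} (hI : ∀ p, f p = 0 → p ∈ I)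
    {t : Poly K n} (ht : t ∈ grading K n 1) {i : Fin (m + 1)} (hi : f (X i) = t) :
    (Proj.map f hf).ker ≤ (specIdealSheaf (chartIdeal I i)).map (chart k i) := by
  subst hi
  refine ((Proj.awayι (grading K n) _ ht one_pos).le_ker_comp (Proj.map f hf)).trans ?_
  rw [Proj.awayι_comp_map f hf one_pos (X i) (X_mem_grading k i), ← map_ker, ker_SpecMap]
  exact map_mono _ (specIdealSheaf_le_iff.2 (ker_awayMap_le f (X_mem_grading k i) hI))

/-- The image of the morphism attached to `f` contains the subscheme defined by an ideal that
contains the kernel of `f`. -/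
theorem ker_map_le_closedSubscheme {I : Ideal (Poly k m)} (hI : ∀ p, f p = 0 → p ∈ I)
    (hX : ∀ i, f (X i) = 0 ∨ ∃ j, f (X i) = X j) :
    (Proj.map f hf).ker ≤ closedSubscheme I := by
  refine le_iInf fun i => ?_
  rcases hX i with h0 | ⟨j, hj⟩
  -- Here `xᵢ ∈ I`, so the subscheme misses the chart `D₊(xᵢ)` and this term of the infimum imposes
  -- no condition.
  · have : chartIdeal I i = ⊤ := awayIdeal_eq_top_of_mem (hI _ h0)
    have htop : specIdealSheaf (chartIdeal I i) = ⊤ := by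
      obtain ⟨J, hJ⟩ := specIdealSheaf_surjective
        (⊤ : (Spec (.of (Away (grading k m) (X i)))).IdealSheafData)
      rw [← hJ]
      refine le_antisymm (hJ ▸ le_top) (specIdealSheaf_le_iff.2 (this ▸ le_top))
    rw [htop, map_top]
    exact le_top
  · exact ker_map_le_map_awayι f hf hI (X_mem_grading K j) hj

end Functoriality

end Charts

/-! ### Hypersurfaces and residual schemes -/

section Residual

open Scheme.IdealSheafData Limits HomogeneousLocalization MvPolynomial

variable {k : Type u} [Field k] {m : ℕ}

/-- Every morphism to the spectrum of a field is flat. -/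
theorem isFlat (T : (ProjSpace k m).IdealSheafData) : IsFlat T :=
  inferInstanceAs (Flat (T.subschemeι ≫ structureMap k m))

theorem isHomogeneous_span_singleton {d : ℕ} {g : Poly k m} (hg : g ∈ grading k m d) :
    (Ideal.span {g}).IsHomogeneous (grading k m) :=
  Ideal.homogeneous_span _ _ (by rintro _ rfl; exact ⟨d, hg⟩)

theorem frac_ne_zero {s : Poly k m} (hs : s ∈ grading k m 1) (hs0 : s ≠ 0) {d : ℕ} {g : Poly k m}
    (hg : g ∈ grading k m d) (hg0 : g ≠ 0) : frac hs d g hg ≠ 0 := by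
  intro h
  have hmem : frac hs d g hg ∈ awayIdeal ⊥ s := by
    rw [h]
    exact zero_mem _
  obtain ⟨N, hN⟩ := (frac_mem_awayIdeal hs hg).1 hmem
  exact mul_ne_zero (pow_ne_zero N hs0) hg0 hN

theorem isDomain_away {s : Poly k m} (hs0 : s ≠ 0) : IsDomain (Away (grading k m) s) := by
  have : IsDomain (Localization.Away s) :=
    IsLocalization.isDomain_localization (powers_le_nonZeroDivisors_of_noZeroDivisors hs0)
  exact Function.Injective.isDomain (algebraMap (Away (grading k m) s) (Localization.Away s))
    (val_injective _)

/-- The residual scheme to a hypersurface `g = 0` in the scheme defined by `g · I`. -/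
theorem colon_closedSubscheme {I : Ideal (Poly k m)} (hI : I.IsHomogeneous (grading k m)) {d : ℕ}
    {g : Poly k m} (hg : g ∈ grading k m d) (hg0 : g ≠ 0) :
    colon (closedSubscheme (Ideal.span {g} * I)) (closedSubscheme (Ideal.span {g})) =
      closedSubscheme I := by
  have hgI := (isHomogeneous_span_singleton hg).mul hI
  apply le_antisymm
  · refine sSup_le fun J hJ => le_iff_forall_chart.2 fun i => ?_
    have h := le_iff_forall_chart.1 (show J * _ ≤ _ from hJ) i
    rw [chartRestrict_mul, chartRestrict_closedSubscheme (isHomogeneous_span_singleton hg),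
      chartRestrict_closedSubscheme hgI] at h
    rw [chartRestrict_closedSubscheme hI]
    change _ * awayIdeal _ _ ≤ awayIdeal _ _ at h
    rw [awayIdeal_singleton_mul (X_mem_grading k i) hI hg,
      awayIdeal_singleton (X_mem_grading k i) hg, mul_comm] at h
    -- In a domain the nonzero local equation `g / xᵢ^d` cancels from `J · (g) ≤ (g) · I`.
    have := isDomain_away (X_ne_zero i : (X i : Poly k m) ≠ 0)
    exact (Ideal.span_singleton_mul_right_mono
      (frac_ne_zero (X_mem_grading k i) (X_ne_zero i) hg hg0)).1 h
  · refine le_sSup (le_iff_forall_chart.2 fun i => ?_)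
    rw [chartRestrict_mul, chartRestrict_closedSubscheme hI,
      chartRestrict_closedSubscheme (isHomogeneous_span_singleton hg),
      chartRestrict_closedSubscheme hgI]
    change awayIdeal _ _ * awayIdeal _ _ ≤ awayIdeal _ _
    rw [awayIdeal_singleton_mul (X_mem_grading k i) hI hg,
      awayIdeal_singleton (X_mem_grading k i) hg, mul_comm]

theorem isInvertible_closedSubscheme {d : ℕ} {g : Poly k m} (hg : g ∈ grading k m d)
    (hg0 : g ≠ 0) : IsInvertible (closedSubscheme (Ideal.span {g})) := by
  intro x
  obtain ⟨i, hi⟩ := TopologicalSpace.Opens.mem_iSup.1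
    ((iSup_opensRange_chart k m).ge (Set.mem_univ x))
  refine ⟨chartOpen (chart k i), ?_, ?_⟩
  · simpa [chartOpen, Scheme.Hom.image_top_eq_opensRange] using hi
  have := isDomain_away (X_ne_zero i : (X i : Poly k m) ≠ 0)
  let e := chartSections (chart k i)
  have : IsDomain Γ(ProjSpace k m, chartOpen (chart k i)) := e.symm.toMulEquiv.isDomain
  have h := chartRestrict_closedSubscheme (isHomogeneous_span_singleton hg) i
  change _ = awayIdeal _ _ at h
  rw [awayIdeal_singleton (X_mem_grading k i) hg, chartRestrict] at h
  have hideal : (closedSubscheme (Ideal.span {g})).ideal (chartOpen (chart k i)) =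
      Ideal.span {e (frac (X_mem_grading k i) d g hg)} := by
    rw [← Ideal.map_comap_of_surjective (e : Away (grading k m) (X i) →+*
      Γ(ProjSpace k m, chartOpen (chart k i))) e.surjective
      ((closedSubscheme (Ideal.span {g})).ideal (chartOpen (chart k i)))]
    refine (congrArg _ h).trans ?_
    rw [Ideal.map_span, Set.image_singleton]
    rfl
  rw [hideal]
  -- A nonzero element of a domain generates a free module of rank one.
  refine ⟨(LinearEquiv.toSpanNonzeroSingleton _ _ _ ?_).symm⟩
  exact (map_ne_zero_iff _ e.injective).2 (frac_ne_zero (X_mem_grading k i) (X_ne_zero i) hg hg0)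

theorem isRelEffCartier_closedSubscheme {d : ℕ} {g : Poly k m} (hg : g ∈ grading k m d)
    (hg0 : g ≠ 0) : IsRelEffCartier d (closedSubscheme (Ideal.span {g})) where
  flat := isFlat _
  invertible := isInvertible_closedSubscheme hg hg0
  degree K _ _ _ := by
    refine ⟨MvPolynomial.map (algebraMap k K) g, ?_, (extendScalarsHom k K m).map_mem hg, ?_⟩
    · exact (map_ne_zero_iff _ (MvPolynomial.map_injective _ (algebraMap k K).injective)).2 hg0
    · rw [extendScalarsMap, comap_map_closedSubscheme _ _ (isHomogeneous_span_singleton hg)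
        fun j => ⟨j, MvPolynomial.map_X _ _⟩, Ideal.map_span, Set.image_singleton]
      rfl

theorem isResidualInclusion_closedSubscheme {I : Ideal (Poly k m)}
    (hI : I.IsHomogeneous (grading k m)) {d : ℕ} {g : Poly k m} (hg : g ∈ grading k m d)
    (hg0 : g ≠ 0) :
    IsResidualInclusion d (closedSubscheme I) (closedSubscheme (Ideal.span {g} * I)) :=
  ⟨closedSubscheme (Ideal.span {g}), isRelEffCartier_closedSubscheme hg hg0,
    closedSubscheme_mono Ideal.mul_le_left, (colon_closedSubscheme hI hg hg0).symm⟩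

end Residual

/-! ### Coordinate planes -/

section CoordinatePlane

open MvPolynomial

variable {k : Type u} [Field k] {m n : ℕ}

theorem isHomogeneous_lexIdeal (D : Fin (m + 1) →₀ ℕ) :
    (lexIdeal k D).IsHomogeneous (grading k m) := by
  refine Ideal.homogeneous_span _ _ ?_
  rintro _ ⟨b, -, rfl⟩
  exact ⟨b.degree, isHomogeneous_monomial _ rfl⟩

/-- The inclusion of the last `n + 1` indices. -/
def lastIndices (h : n ≤ m) (j : Fin (n + 1)) : Fin (m + 1) := ⟨m - n + j, by omega⟩

theorem lastIndices_injective (h : n ≤ m) : Function.Injective (lastIndices h) := fun i j hij => by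
  simp only [lastIndices, Fin.mk.injEq] at hij
  omega

theorem lastIndices_zero (h : n ≤ m) : lastIndices h 0 = varIndex m n := rfl

theorem lt_or_eq_lastIndices (h : n ≤ m) (i : Fin (m + 1)) :
    i < varIndex m n ∨ ∃ j, i = lastIndices h j := by
  rcases lt_or_ge i (varIndex m n) with hi | hi
  · exact Or.inl hi
  · rw [Fin.le_def] at hi
    simp only [varIndex] at hi
    refine Or.inr ⟨⟨i - (m - n), by omega⟩, Fin.ext ?_⟩
    simp only [lastIndices]
    omega

/-- The projection `kᵐ⁺¹ → kⁿ⁺¹` onto the last coordinates. -/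
def lastProj (k : Type u) [Field k] (h : n ≤ m) : (Fin (m + 1) → k) →ₗ[k] (Fin (n + 1) → k) :=
  LinearMap.funLeft k k (lastIndices h)

theorem lastProj_surjective (h : n ≤ m) : Function.Surjective (lastProj k h) :=
  LinearMap.funLeft_surjective_of_injective k k _ (lastIndices_injective h)

theorem symHom_lastProj_X (h : n ≤ m) (i : Fin (m + 1)) : symHom (lastProj k h) (X i) =
    ∑ j : Fin (n + 1), (Pi.single i 1 : Fin (m + 1) → k) (lastIndices h j) • X j :=
  aeval_X _ i

theorem symHom_lastProj_X_lastIndices (h : n ≤ m) (j : Fin (n + 1)) :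
    symHom (lastProj k h) (X (lastIndices h j)) = X j := by
  rw [symHom_lastProj_X, Finset.sum_eq_single j]
  · simp
  · intro i _ hij
    rw [Pi.single_eq_of_ne ((lastIndices_injective h).ne hij), zero_smul]
  · simp

theorem symHom_lastProj_X_of_lt (h : n ≤ m) {i : Fin (m + 1)} (hi : i < varIndex m n) :
    symHom (lastProj k h) (X i) = 0 := by
  rw [symHom_lastProj_X]
  refine Finset.sum_eq_zero fun j _ => ?_
  rw [Pi.single_eq_of_ne, zero_smul]
  rintro rfl
  rw [Fin.lt_def] at hi
  simp only [varIndex, lastIndices] at hi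
  omega

theorem symHom_eq_aeval (φ : (Fin (m + 1) → k) →ₗ[k] (Fin (n + 1) → k)) (p : Poly k m) :
    symHom φ p = aeval (fun i => symHom φ (X i)) p := by
  have h : (fun i => symHom φ (X i)) = fun i : Fin (m + 1) =>
      ∑ j : Fin (n + 1), φ (Pi.single i 1) j • (X j : Poly k n) :=
    funext fun i => aeval_X _ i
  rw [h]
  rfl

/-- Restricting to the plane and then renaming the variables back sets the first `m - n` variables
to zero; this is the identity modulo `I`, which contains them. -/
theorem mem_of_symHom_lastProj_eq_zero (h : n ≤ m) {I : Ideal (Poly k m)}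
    (hI : ∀ q < varIndex m n, X q ∈ I) (p : Poly k m) (hp : symHom (lastProj k h) p = 0) :
    p ∈ I := by
  have hcomp : (Ideal.Quotient.mkₐ k I).comp ((rename (lastIndices h)).comp
      (aeval fun i : Fin (m + 1) => symHom (lastProj k h) (X i))) = Ideal.Quotient.mkₐ k I := by
    refine algHom_ext fun i => ?_
    rw [AlgHom.comp_apply, AlgHom.comp_apply, aeval_X]
    rcases lt_or_eq_lastIndices h i with hi | ⟨j, rfl⟩
    · rw [symHom_lastProj_X_of_lt h hi, map_zero, map_zero]
      exact (Ideal.Quotient.eq_zero_iff_mem.2 (hI i hi)).symm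
    · rw [symHom_lastProj_X_lastIndices, rename_X]
  have hf : aeval (fun i : Fin (m + 1) => symHom (lastProj k h) (X i)) p = 0 := by
    rw [← symHom_eq_aeval, hp]
  have := DFunLike.congr_fun hcomp p
  rw [AlgHom.comp_apply, AlgHom.comp_apply, hf, map_zero, map_zero] at this
  exact Ideal.Quotient.eq_zero_iff_mem.1 this.symm

theorem map_lexIdeal_single_add (f : grading k m →+*ᵍ grading k n) {p : Fin (m + 1)}
    (hf : ∀ q < p, f (X q) = 0) {D : Fin (m + 1) →₀ ℕ} {d : ℕ} (hD : ∀ r < p, D r = 0) :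
    (lexIdeal k (Finsupp.single p d + D)).map f =
      Ideal.span {f (X p) ^ d} * (lexIdeal k D).map f := by
  have hle : (Ideal.span (X '' Set.Iio p)).map f ≤ ⊥ := by
    rw [Ideal.map_span, Ideal.span_le]
    rintro _ ⟨_, ⟨q, hq, rfl⟩, rfl⟩
    exact hf q hq
  rw [lexIdeal_single_add hD, Ideal.map_sup, le_bot_iff.1 hle, bot_sup_eq, Ideal.map_mul,
    Ideal.map_span f {X p ^ d}, Set.image_singleton, map_pow]

/-- One step of the residual flag. -/
theorem exists_plane_residual (h : n ≤ m) {D : Fin (m + 1) →₀ ℕ} {d : ℕ}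
    (hD : ∀ r < varIndex m n, D r = 0) :
    ∃ (φ : (Fin (m + 1) → k) →ₗ[k] (Fin (n + 1) → k)) (hφ : Function.Surjective φ),
      (planeMap φ hφ).ker ≤
        closedSubscheme (lexIdeal k (Finsupp.single (varIndex m n) d + D)) ∧
      IsResidualInclusion d ((closedSubscheme (lexIdeal k D)).comap (planeMap φ hφ))
        ((closedSubscheme (lexIdeal k (Finsupp.single (varIndex m n) d + D))).comap
          (planeMap φ hφ)) := by
  have hX : ∀ j, ∃ i, symHom (lastProj k h) (X i) = X j := fun j =>
    ⟨_, symHom_lastProj_X_lastIndices h j⟩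
  refine ⟨lastProj k h, lastProj_surjective h, ?_, ?_⟩
  · refine ker_map_le_closedSubscheme _ _ (mem_of_symHom_lastProj_eq_zero h fun q hq => ?_)
      fun i => ?_
    · rw [lexIdeal_single_add hD]
      exact Ideal.mem_sup_left (Ideal.subset_span ⟨q, hq, rfl⟩)
    · rcases lt_or_eq_lastIndices h i with hi | ⟨j, rfl⟩
      · exact Or.inl (symHom_lastProj_X_of_lt h hi)
      · exact Or.inr ⟨j, symHom_lastProj_X_lastIndices h j⟩
  · rw [planeMap, comap_map_closedSubscheme _ _ (isHomogeneous_lexIdeal _) hX,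
      comap_map_closedSubscheme _ _ (isHomogeneous_lexIdeal _) hX,
      -- The variable `x_{m - n}` restricts to the first coordinate `x_0` of the plane, so the
      -- divisor is `x_0^d = 0`.
      map_lexIdeal_single_add _ (fun q hq => symHom_lastProj_X_of_lt h hq) hD, ← lastIndices_zero h,
      symHom_lastProj_X_lastIndices h 0]
    exact isResidualInclusion_closedSubscheme (isHomogeneous_map _ (isHomogeneous_lexIdeal _))
      (pow_mem_grading (X_mem_grading k 0) d) (pow_ne_zero d (X_ne_zero 0))

end CoordinatePlane

/-! ### The partitions of a flag type -/

section FlagType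

variable {m e : ℕ} {n d : Fin e → ℕ}

/-- The partition formed by the parts from position `t` on; it is empty for `t = e`. -/
def dropPartition (n d : Fin e → ℕ) (t : ℕ) : List ℕ :=
  ((List.finRange e).drop t).flatMap fun j => List.replicate (d j) (n j)

theorem dropPartition_eq_append (i : Fin e) :
    dropPartition n d i = List.replicate (d i) (n i) ++ dropPartition n d (i + 1) := by
  have hi : (i : ℕ) < (List.finRange e).length := by simp
  rw [dropPartition, List.drop_eq_getElem_cons hi, List.flatMap_cons, List.getElem_finRange]
  rfl

theorem dropPartition_self : dropPartition n d e = [] := by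
  rw [dropPartition, List.drop_eq_nil_of_le (by simp), List.flatMap_nil]

theorem exists_of_mem_dropPartition {t a : ℕ} (ha : a ∈ dropPartition n d t) :
    ∃ j : Fin e, t ≤ j ∧ a = n j := by
  obtain ⟨j, hj, haj⟩ := List.mem_flatMap.1 ha
  obtain ⟨i, hi, rfl⟩ := List.mem_drop_iff_getElem.1 hj
  refine ⟨_, ?_, List.eq_of_mem_replicate haj⟩
  simp

theorem pairwise_dropPartition (hn : StrictAnti n) (t : ℕ) :
    (dropPartition n d t).Pairwise (· ≥ ·) := by
  refine List.pairwise_flatMap.2 ⟨fun j _ => List.pairwise_replicate.2 (Or.inr le_rfl), ?_⟩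
  refine ((List.pairwise_lt_finRange e).drop).imp fun {i j} hij a ha b hb => ?_
  rw [List.eq_of_mem_replicate ha, List.eq_of_mem_replicate hb]
  exact (hn hij).le

theorem isLexIdealOf_dropPartition {k : Type u} [Field k] (h : IsFlagType m n d) (t : ℕ) :
    IsLexIdealOf (dropPartition n d t) (lexIdeal k (partExponent m (dropPartition n d t))) := by
  refine isLexIdealOf_lexIdeal (pairwise_dropPartition h.strictAnti t) (fun a ha => ?_)
    fun a ha => ?_
  · obtain ⟨j, -, rfl⟩ := exists_of_mem_dropPartition ha
    exact h.n_pos j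
  · obtain ⟨j, -, rfl⟩ := exists_of_mem_dropPartition ha
    exact h.n_le j

theorem partExponent_dropPartition (i : Fin e) :
    partExponent m (dropPartition n d i) =
      Finsupp.single (varIndex m (n i)) (d i) + partExponent m (dropPartition n d (i + 1)) := by
  rw [dropPartition_eq_append, partExponent_append, partExponent_replicate]

/-- Later parts are smaller, so their variables come after `x_{m - nᵢ}`; this is the hypothesis of
the factorization. -/
theorem partExponent_dropPartition_succ_apply (hn : StrictAnti n) (i : Fin e)
    {r : Fin (m + 1)} (hr : r < varIndex m (n i)) :
    partExponent m (dropPartition n d (i + 1)) r = 0 := by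
  refine partExponent_apply_eq_zero ?_
  rintro a ha rfl
  obtain ⟨j, hj, rfl⟩ := exists_of_mem_dropPartition ha
  have := hn (show i < j from hj)
  rw [Fin.lt_def] at hr
  simp only [varIndex] at hr
  omega

end FlagType

/-! ### Assembling the residual flag. -/

theorem isResidualFlag_of_isFlagType {k : Type u} [Field k] {m e : ℕ} {n d : Fin e → ℕ}
    (hnd : IsFlagType m n d) :
    IsResidualFlag n d fun t : Fin (e + 1) =>
      closedSubscheme (lexIdeal k (partExponent m (dropPartition n d t))) where
  last_eq_empty := by
    rw [Fin.val_last, dropPartition_self, partExponent, List.map_nil, List.sum_nil, lexIdeal_zero,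
      closedSubscheme_top]
  chain i := by
    refine closedSubscheme_mono (lexIdeal_anti ?_)
    rw [Fin.val_castSucc, Fin.val_succ, partExponent_dropPartition]
    exact Finsupp.toLex_monotone le_add_self
  flat i := isFlat _
  residual i := by
    rw [Fin.val_castSucc, Fin.val_succ, partExponent_dropPartition]
    exact exists_plane_residual (hnd.n_le i) fun r hr =>
      partExponent_dropPartition_succ_apply hnd.strictAnti i hr

end ResidualFlag

end

theorem corollaryc {k : Type u} [Field k] {m e : ℕ} {n d : Fin e → ℕ}
    (hnd : ResidualFlag.IsFlagType m n d) :
    (∀ i : Fin e, ∃! L : Ideal (ResidualFlag.Poly k m),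
      ResidualFlag.IsLexIdealOf (ResidualFlag.tailPartition n d i) L) ∧
    ∀ L : Fin e → Ideal (ResidualFlag.Poly k m),
      (∀ i, ResidualFlag.IsLexIdealOf (ResidualFlag.tailPartition n d i) (L i)) →
      ResidualFlag.IsResidualFlag n d
        (Fin.snoc (fun i => ResidualFlag.closedSubscheme (L i)) ⊤) := by
  have hlex : ∀ i : Fin e, ResidualFlag.IsLexIdealOf (ResidualFlag.tailPartition n d i)
      (ResidualFlag.lexIdeal k
        (ResidualFlag.partExponent m (ResidualFlag.dropPartition n d i))) := fun i =>
    ResidualFlag.isLexIdealOf_dropPartition hnd i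
  refine ⟨fun i => ⟨_, hlex i, fun L hL => hL.unique (hlex i)⟩, fun L hL => ?_⟩
  have hflag := ResidualFlag.isResidualFlag_of_isFlagType (k := k) hnd
  -- Uniqueness identifies each given `L i` with the explicit ideal. The last term `⊤` matches
  -- because the empty partition gives the unit ideal, hence the empty scheme.
  convert hflag using 1
  funext t
  refine Fin.lastCases ?_ (fun i => ?_) t
  · rw [Fin.snoc_last]
    exact hflag.last_eq_empty.symm
  · rw [Fin.snoc_castSucc, (hL i).unique (hlex i)]
    rfl
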